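/- **Definitions.** A *binary linear code* of length $n$ is a linear subspace $C\subseteq\mathbb F_2^n$; its *weight enumerator* is $W_C(x)=\sum_{c\in C}x^{w(c)}$, where $w(c)$ is the number of non-zero entries of $c$. A *triangular configuration* $\Delta$ is a finite 2-dimensional simplicial complex in some $\mathbb R^d$ each of whose maximal simplices is an edge or a triangle. It is *tripartite* if its edges can be divided into three disjoint sets $E_1,E_2,E_3$ (a tripartition) such that every triangle of $\Delta$ contains edges from all three. Given weights $w(t)$ of the triangles $t$ of $\Delta$, the *triadjacency 3-matrix* $A_\Delta(x)$ is the $|E_1|\times|E_2|\times|E_3|$ array whose entry at $(i,j,l)$ is $x^{w(t)}$ if the $i$-th edge of $E_1$, the $j$-th edge of $E_2$ and the $l$-th edge of $E_3$ form a triangle $t$ of $\Delta$, and $0$ otherwise. The *permanent* of an $N\times N\times N$ 3-matrix $A=(a_{ijl})$ is $\mathrm{Per}(A)=\sum_{\sigma_1,\sigma_2\in S_N}\prod_{i=1}^N a_{i\sigma_1(i)\sigma_2(i)}$. **Theorem 1.1.** There are integers $\alpha\ge 0$ and $\beta\ge 1$ such that, with $e=\alpha n+\beta$, the following holds for every $n$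 and every binary linear code $C$ of length $n$. There is a tripartite triangular configuration $\Delta$, with a tripartition $E_1,E_2,E_3$ such that $|E_1|=|E_2|=|E_3|=N$ and with non-negative integer weights of its triangles, such that, if $\mathrm{Per}(A_\Delta(x))=\sum_{i=0}^m a_ix^i$, then $i\bmod e$ is even whenever $a_i\neq 0$, and $$W_C(x)=\sum_{i=0}^m a_i\,x^{(i\bmod e)/2}.$$ Moreover this is a polynomial-time reduction of the weight enumerator to the permanent of a 3-matrix: $\Delta$, its tripartition, its weights and the order of the edges in each $E_p$ can be chosen, for each generator matrix of $C$ (a matrix whose rows form a basis of $C$), in such a way that $N$ and all the weights are bounded by a fixed polynomial in $n$, and that a fixed algorithm (a program of a random access machine with addition and subtraction at unit cost) computes the 3-matrix $A_\Delta(x)$ from the generator matrix in a number of steps bounded by a fixed polynomial in $n$. -/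

import Mathlib

open scoped Polynomial

/-! ### Binary linear codes -/

open Classical in
/-- The weight enumerator `W_C(x) = ∑_{c ∈ C} x ^ w(c)`, where `w(c)` is the number of non-zero
entries of the codeword `c`. -/
noncomputable def weightEnumerator {n : ℕ} (C : Submodule (ZMod 2) (Fin n → ZMod 2)) : ℕ[X] :=
  ∑ c : Fin n → ZMod 2 with c ∈ C, Polynomial.X ^ hammingNorm c

/-- `G` is a generator matrix of the code `C`: its rows form a basis of `C`. -/
def IsGeneratorMatrix {k n : ℕ} (G : Matrix (Fin k) (Fin n) (ZMod 2))
    (C : Submodule (ZMod 2) (Fin n → ZMod 2)) : Prop :=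
  LinearIndependent (ZMod 2) G.row ∧ Submodule.span (ZMod 2) (Set.range G.row) = C

/-- Every binary linear code has a generator matrix. -/
theorem exists_isGeneratorMatrix {n : ℕ} (C : Submodule (ZMod 2) (Fin n → ZMod 2)) :
    ∃ (k : ℕ) (G : Matrix (Fin k) (Fin n) (ZMod 2)), IsGeneratorMatrix G C := by
  let b := Module.finBasis (ZMod 2) C
  refine ⟨_, fun i => (b i : Fin n → ZMod 2), ?_, ?_⟩
  · exact b.linearIndependent.map' C.subtype C.ker_subtype
  · have h := congrArg (Submodule.map C.subtype) b.span_eq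
    rw [Submodule.map_span, Submodule.map_top, Submodule.range_subtype, ← Set.range_comp] at h
    exact h

/-! ### 3-matrices -/

/-- The permanent of an `N × N × N` 3-matrix. -/
def permanent3 {R : Type*} [CommSemiring R] {N : ℕ} (A : Fin N → Fin N → Fin N → R) : R :=
  ∑ σ₁ : Equiv.Perm (Fin N), ∑ σ₂ : Equiv.Perm (Fin N), ∏ i, A i (σ₁ i) (σ₂ i)

/-! ### Triangular configurations -/

/-- A triangular configuration: a finite 2-dimensional simplicial complex in some `ℝ^d` each of
whose maximal simplices is an edge or a triangle. As in Mathlib, a simplex is given by its finite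
set of vertices. -/
structure TriangularConfiguration where
  /-- the dimension of the ambient space -/
  d : ℕ
  /-- the simplicial complex -/
  complex : Geometry.SimplicialComplex ℝ (EuclideanSpace ℝ (Fin d))
  finite : complex.faces.Finite
  exists_triangle : ∃ t ∈ complex.faces, t.card = 3
  card_facet : ∀ s ∈ complex.facets, s.card = 2 ∨ s.card = 3

namespace TriangularConfiguration

/-- The set of edges `E(Δ)`. -/
def edges (Δ : TriangularConfiguration) : Set (Finset (EuclideanSpace ℝ (Fin Δ.d))) :=
  {s | s ∈ Δ.complex.faces ∧ s.card = 2}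

/-- The set of triangles `T(Δ)`. -/
def triangles (Δ : TriangularConfiguration) : Set (Finset (EuclideanSpace ℝ (Fin Δ.d))) :=
  {s | s ∈ Δ.complex.faces ∧ s.card = 3}

/-- A tripartition of `Δ`: a division of the edges into three pairwise disjoint sets such that
every triangle contains edges from all three of them. -/
structure Tripartition (Δ : TriangularConfiguration) where
  /-- the three sets of edges -/
  part : Fin 3 → Set (Finset (EuclideanSpace ℝ (Fin Δ.d)))
  iUnion_part : ⋃ i, part i = Δ.edges
  disjoint_part : ∀ i j, i ≠ j → Disjoint (part i) (part j)
  exists_edge : ∀ t ∈ Δ.triangles, ∀ i, ∃ e ∈ part i, e ⊆ t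

open Classical in
/-- The triadjacency 3-matrix `A_Δ(x)` of `Δ` with respect to a tripartition into three sets of `N`
edges each, listed by `ν`, and weights `w` of the triangles: the entry at `(i, j, l)` is `x ^ w(t)`
if the `i`-th edge of the first set, the `j`-th edge of the second set and the `l`-th edge of the
third set form a triangle `t`, and `0` otherwise. (Three different edges form the triangle `t`
exactly if the union of their vertex sets is the vertex set of `t`.) -/
noncomputable def triadjacency (Δ : TriangularConfiguration) (E : Δ.Tripartition)
    (w : Δ.triangles → ℕ) {N : ℕ} (ν : ∀ p : Fin 3, Fin N ≃ E.part p) (i j l : Fin N) : ℕ[X] :=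
  if h : (ν 0 i : Finset (EuclideanSpace ℝ (Fin Δ.d))) ∪ (ν 1 j) ∪ (ν 2 l) ∈ Δ.triangles then
    Polynomial.X ^ w ⟨_, h⟩
  else 0

end TriangularConfiguration

/-! ### Random access machines -/

namespace RAM

/-- A configuration of the machine: the registers and the random access memory, both holding
natural numbers. -/
structure State where
  /-- the registers -/
  reg : ℕ → ℕ
  /-- the memory -/
  mem : ℕ → ℕ

/-- Structured programs of a random access machine with addition and (truncated) subtraction.
There is no multiplication, so numbers have polynomially many bits after polynomially many steps
and the unit-cost machine is polynomially equivalent to a Turing machine. -/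
inductive Program where
  /-- `reg r := c`, for a constant `c` -/
  | const (r c : ℕ)
  /-- `reg r := reg a + reg b` -/
  | add (r a b : ℕ)
  /-- `reg r := reg a - reg b`, truncated at zero -/
  | sub (r a b : ℕ)
  /-- `reg r := mem (reg a)` -/
  | load (r a : ℕ)
  /-- `mem (reg a) := reg r` -/
  | store (a r : ℕ)
  /-- `P` followed by `Q` -/
  | seq (P Q : Program)
  /-- if `reg r ≠ 0` then `P` else `Q` -/
  | cond (r : ℕ) (P Q : Program)
  /-- while `reg r ≠ 0` do `P` -/
  | loop (r : ℕ) (P : Program)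

/-- `Runs P s t s'`: started in the state `s`, the program `P` halts after exactly `t` steps in the
state `s'`. Every elementary instruction and every test is one step. -/
inductive Runs : Program → State → ℕ → State → Prop where
  | const (r c : ℕ) (s : State) :
      Runs (.const r c) s 1 ⟨Function.update s.reg r c, s.mem⟩
  | add (r a b : ℕ) (s : State) :
      Runs (.add r a b) s 1 ⟨Function.update s.reg r (s.reg a + s.reg b), s.mem⟩
  | sub (r a b : ℕ) (s : State) :
      Runs (.sub r a b) s 1 ⟨Function.update s.reg r (s.reg a - s.reg b), s.mem⟩
  | load (r a : ℕ) (s : State) :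
      Runs (.load r a) s 1 ⟨Function.update s.reg r (s.mem (s.reg a)), s.mem⟩
  | store (a r : ℕ) (s : State) :
      Runs (.store a r) s 1 ⟨s.reg, Function.update s.mem (s.reg a) (s.reg r)⟩
  | seq {P Q : Program} {s s' s'' : State} {t t' : ℕ} :
      Runs P s t s' → Runs Q s' t' s'' → Runs (.seq P Q) s (t + t') s''
  | cond_true {r : ℕ} {P Q : Program} {s s' : State} {t : ℕ} :
      s.reg r ≠ 0 → Runs P s t s' → Runs (.cond r P Q) s (1 + t) s'
  | cond_false {r : ℕ} {P Q : Program} {s s' : State} {t : ℕ} :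
      s.reg r = 0 → Runs Q s t s' → Runs (.cond r P Q) s (1 + t) s'
  | loop_stop {r : ℕ} {P : Program} {s : State} :
      s.reg r = 0 → Runs (.loop r P) s 1 s
  | loop_step {r : ℕ} {P : Program} {s s' s'' : State} {t t' : ℕ} :
      s.reg r ≠ 0 → Runs P s t s' → Runs (.loop r P) s' t' s'' →
        Runs (.loop r P) s (1 + t + t') s''

/-- `s` is the initial state for the `k × n` binary matrix `G`: the memory holds `k`, then `n`, then
the entries of `G` row by row, and everything else is zero. -/
def IsInput {k n : ℕ} (G : Matrix (Fin k) (Fin n) (ZMod 2)) (s : State) : Prop :=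
  (∀ r, s.reg r = 0) ∧ s.mem 0 = k ∧ s.mem 1 = n ∧
    (∀ (i : Fin k) (j : Fin n), s.mem (2 + i * n + j) = (G i j).val) ∧
    ∀ a, 2 + k * n ≤ a → s.mem a = 0

/-- The number that stores an entry of a 3-matrix all of whose entries are `0` or powers of `x`:
`0` is stored as `0` and `x ^ w` as `w + 1`. -/
noncomputable def entryCode (p : ℕ[X]) : ℕ :=
  if p = 0 then 0 else p.natDegree + 1

/-- The state `s` holds the `N × N × N` 3-matrix `A`: register `0` contains `N`, register `1`
contains an address, and the `N ^ 3` entries, in lexicographic order of their indices, are stored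
in the memory from this address on. -/
def IsOutput {N : ℕ} (A : Fin N → Fin N → Fin N → ℕ[X]) (s : State) : Prop :=
  s.reg 0 = N ∧
    ∀ i j l : Fin N, s.mem (s.reg 1 + ((i * N + j) * N + l)) = entryCode (A i j l)

/-- Given the matrix `G`, the program `P` halts after at most `T` steps with output `A`. -/
def ComputesWithin (P : Program) {k n : ℕ} (G : Matrix (Fin k) (Fin n) (ZMod 2)) {N : ℕ}
    (A : Fin N → Fin N → Fin N → ℕ[X]) (T : ℕ) : Prop :=
  ∀ s, IsInput G s → ∃ t s', t ≤ T ∧ Runs P s t s' ∧ IsOutput A s'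

end RAM

/-! Let G be a generator matrix of C with k rows. Its rows form a basis, so W_C(x) is the sum of
x^{w(uG)} over all messages u (`weightEnumerator_eq_sum`). On the other side, the permanent of a
3-matrix whose entries come from triangles enumerates, by total weight, the sets of triangles that
cover every edge exactly once (`permanent3_eq_sum_exactCover`). It therefore suffices to build
triangles whose exact covers correspond to the messages, the cover of u having weight 2w(uG). As e =
2n + 1 exceeds all these exponents, reduction modulo e changes nothing.

The triangles form a cyclic grid with r > k rows (bits) and m ≥ n columns (coordinates), G being
extended by zeros. The ring of triangles along row i is covered in one of two ways, white for u_i =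
0 and black for u_i = 1; rows outside G must be white. White triangles cover the row nodes. In a
black row, the row node of the cell (i, j) is covered by the triangle 0, present if G_ij = 0, or by
one of the gadgets p and q, present if G_ij = 1. The gadget p also covers the column node of the
same cell, q that of the next row, and a third gadget covers two consecutive column nodes.

Let s_i be 1 if the column node in row i of a fixed column j is covered from row i - 1. Going down
the column, the choices are forced and s_{i+1} = s_i + 1 + G_ij u_i in 𝔽₂, starting from s_0 = 0
because nothing passes from the last row to the first. Hence s_{r-1} = r - 1 + (uG)_j. For even r,
the last column node is left over exactly if (uG)_j = 1. It is then covered by the triangle 4, which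
exists only in the last row and has weight 2, all other weights being 0.

The equations are extracted in `cover_eq_one_iff`; `isExactCover_chosen`, `chosen_injective` and
`exists_eq_chosen` give the bijection, and `sum_weight_chosen` the weight. For the geometry, all
vertices are placed at the standard basis vectors of some ℝ^d, and a 3-colouring of the vertices
gives the tripartition. The algorithm visits the cells one by one and adds the entries of their
triangles into memory. Multiplication is repeated addition, which is affordable because all operands
are polynomially bounded. -/

/-! ### Realizing tripartite triangle systems -/

/-- A tripartite system of triangles on the vertex set `V`: three disjoint families of `N` edges
each, and triangles indexed by `τ`, the triangle `t` having the edges `inc p t`, one of each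
family. -/
structure TriangleSystem (V τ : Type*) (N : ℕ) where
  /-- the edges of the three families -/
  edge : Fin 3 → Fin N → Finset V
  /-- the vertex sets of the triangles -/
  triangle : τ → Finset V
  /-- the edges of the triangles -/
  inc : Fin 3 → τ → Fin N
  card_edge : ∀ p i, (edge p i).card = 2
  edge_inj : ∀ p q i j, edge p i = edge q j → p = q ∧ i = j
  card_triangle : ∀ t, (triangle t).card = 3
  edge_subset : ∀ p t, edge p (inc p t) ⊆ triangle t
  inc_inj : ∀ t t', (∀ p, inc p t = inc p t') → t = t'

namespace TriangleSystem

variable {V τ : Type*} {N : ℕ} (S : TriangleSystem V τ N)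

/-- Every two-element subset of a triangle is one of its three edges. -/
theorem exists_eq_edge {s : Finset V} {t : τ} (hs : s.card = 2) (hst : s ⊆ S.triangle t) :
    ∃ p, s = S.edge p (S.inc p t) := by
  classical
  have hinj : Function.Injective fun p => S.edge p (S.inc p t) :=
    fun p q h => (S.edge_inj _ _ _ _ h).1
  have h : Finset.univ.image (fun p => S.edge p (S.inc p t)) =
      Finset.powersetCard 2 (S.triangle t) := by
    apply Finset.eq_of_subset_of_card_le
    · intro u hu
      obtain ⟨p, -, rfl⟩ := Finset.mem_image.1 hu
      exact Finset.mem_powersetCard.2 ⟨S.edge_subset p t, S.card_edge _ _⟩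
    · rw [Finset.card_powersetCard, Finset.card_image_of_injective _ hinj, S.card_triangle]
      decide
  have := Finset.mem_powersetCard.2 ⟨hst, hs⟩
  rw [← h] at this
  obtain ⟨p, -, hp⟩ := Finset.mem_image.1 this
  exact ⟨p, hp.symm⟩

/-- This excludes accidental incidences: the three prescribed edges already exhaust the pairs of
vertices of the triangle. -/
theorem eq_inc_of_subset {p : Fin 3} {i : Fin N} {t : τ} (h : S.edge p i ⊆ S.triangle t) :
    i = S.inc p t := by
  obtain ⟨q, hq⟩ := S.exists_eq_edge (S.card_edge p i) h
  obtain ⟨rfl, h⟩ := S.edge_inj _ _ _ _ hq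
  exact h

theorem union_edge_eq [DecidableEq V] (t : τ) :
    S.edge 0 (S.inc 0 t) ∪ S.edge 1 (S.inc 1 t) ∪ S.edge 2 (S.inc 2 t) = S.triangle t := by
  apply Finset.eq_of_subset_of_card_le
  · exact Finset.union_subset (Finset.union_subset (S.edge_subset _ _) (S.edge_subset _ _))
      (S.edge_subset _ _)
  · rw [S.card_triangle]
    by_contra h
    -- A union with at most two vertices would equal both the first and the second edge.
    have h0 := Finset.eq_of_subset_of_card_le (s := S.edge 0 (S.inc 0 t))
      (t := S.edge 0 (S.inc 0 t) ∪ S.edge 1 (S.inc 1 t) ∪ S.edge 2 (S.inc 2 t))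
      (Finset.subset_union_left.trans Finset.subset_union_left) (by rw [S.card_edge]; omega)
    have h1 := Finset.eq_of_subset_of_card_le (s := S.edge 1 (S.inc 1 t))
      (t := S.edge 0 (S.inc 0 t) ∪ S.edge 1 (S.inc 1 t) ∪ S.edge 2 (S.inc 2 t))
      (Finset.subset_union_right.trans Finset.subset_union_left) (by rw [S.card_edge]; omega)
    have := (S.edge_inj _ _ _ _ (h0.trans h1.symm)).1
    simp at this

theorem triangle_injective : Function.Injective S.triangle := fun t t' h =>
  S.inc_inj t t' fun p => S.eq_inc_of_subset (h ▸ S.edge_subset p t)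

/-- The image of a triangle system under an embedding of the vertices. -/
def map {W : Type*} (f : V ↪ W) : TriangleSystem W τ N where
  edge p i := (S.edge p i).map f
  triangle t := (S.triangle t).map f
  inc := S.inc
  card_edge p i := by rw [Finset.card_map, S.card_edge]
  edge_inj p q i j h := S.edge_inj p q i j (Finset.map_injective f h)
  card_triangle t := by rw [Finset.card_map, S.card_triangle]
  edge_subset p t := Finset.map_subset_map.2 (S.edge_subset p t)
  inc_inj := S.inc_inj

/-- The simplices of a triangle system: the non-empty subsets of its edges and triangles. -/
def faces : Set (Finset V) :=
  {s | s.Nonempty ∧ ((∃ p i, s ⊆ S.edge p i) ∨ ∃ t, s ⊆ S.triangle t)}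

theorem edge_mem_faces (p : Fin 3) (i : Fin N) : S.edge p i ∈ S.faces :=
  ⟨Finset.card_pos.1 (by rw [S.card_edge]; omega), .inl ⟨p, i, subset_rfl⟩⟩

theorem triangle_mem_faces (t : τ) : S.triangle t ∈ S.faces :=
  ⟨Finset.card_pos.1 (by rw [S.card_triangle]; omega), .inr ⟨t, subset_rfl⟩⟩

theorem mem_faces_card_two {s : Finset V} : s ∈ S.faces ∧ s.card = 2 ↔ ∃ p i, s = S.edge p i := by
  constructor
  · rintro ⟨⟨-, ⟨p, i, h⟩ | ⟨t, h⟩⟩, hs⟩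
    · exact ⟨p, i, Finset.eq_of_subset_of_card_le h (by rw [S.card_edge, hs])⟩
    · obtain ⟨p, hp⟩ := S.exists_eq_edge hs h
      exact ⟨p, _, hp⟩
  · rintro ⟨p, i, rfl⟩
    exact ⟨S.edge_mem_faces p i, S.card_edge p i⟩

theorem mem_faces_card_three {s : Finset V} :
    s ∈ S.faces ∧ s.card = 3 ↔ ∃ t, s = S.triangle t := by
  constructor
  · rintro ⟨⟨-, ⟨p, i, h⟩ | ⟨t, h⟩⟩, hs⟩
    · have := Finset.card_le_card h
      rw [S.card_edge] at this
      omega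
    · exact ⟨t, Finset.eq_of_subset_of_card_le h (by rw [S.card_triangle, hs])⟩
  · rintro ⟨t, rfl⟩
    exact ⟨S.triangle_mem_faces t, S.card_triangle t⟩

theorem finite_faces [Finite τ] : S.faces.Finite := by
  have : S.faces ⊆ (⋃ p, ⋃ i, ((S.edge p i).powerset : Set (Finset V))) ∪
      ⋃ t, ((S.triangle t).powerset : Set (Finset V)) := by
    rintro s ⟨-, ⟨p, i, h⟩ | ⟨t, h⟩⟩
    · exact .inl (Set.mem_iUnion₂.2 ⟨p, i, by simpa using h⟩)
    · exact .inr (Set.mem_iUnion.2 ⟨t, by simpa using h⟩)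
  refine Set.Finite.subset (Set.Finite.union ?_ ?_) this
  · exact Set.finite_iUnion fun p => Set.finite_iUnion fun i => Finset.finite_toSet _
  · exact Set.finite_iUnion fun t => Finset.finite_toSet _

/-- The triangular configuration of a triangle system whose vertices are affinely independent
points. -/
def toConfiguration {d : ℕ} (S : TriangleSystem (EuclideanSpace ℝ (Fin d)) τ N) [Finite τ]
    [Nonempty τ] {P : Set (EuclideanSpace ℝ (Fin d))}
    (hP : AffineIndependent ℝ ((↑) : P → EuclideanSpace ℝ (Fin d)))
    (hSP : ∀ s ∈ S.faces, (s : Set (EuclideanSpace ℝ (Fin d))) ⊆ P) : TriangularConfiguration where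
  d := d
  complex :=
    { faces := S.faces
      isRelLowerSet_faces := fun s hs => ⟨hs.1, fun u hu hne => ⟨hne,
        hs.2.imp (fun ⟨p, i, h⟩ => ⟨p, i, hu.trans h⟩) fun ⟨t, h⟩ => ⟨t, hu.trans h⟩⟩⟩
      indep := fun hs => hP.mono (hSP _ hs)
      inter_subset_convexHull := fun {s t} hs ht => by
        classical
        -- Inside one affinely independent set, the hulls of two subsets meet in the hull of their
        -- intersection.
        refine subset_of_eq (AffineIndependent.convexHull_inter (R := ℝ) (s := s ∪ t) ?_
          Finset.subset_union_left Finset.subset_union_right).symm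
        exact hP.mono fun x hx => (Finset.mem_union.1 hx).elim (hSP s hs ·) (hSP t ht ·) }
  finite := S.finite_faces
  exists_triangle := ⟨_, S.mem_faces_card_three.2 ⟨Classical.arbitrary τ, rfl⟩⟩
  card_facet s hs := by
    rw [Geometry.SimplicialComplex.mem_facets] at hs
    obtain ⟨⟨-, ⟨p, i, h⟩ | ⟨t, h⟩⟩, hmax⟩ := hs
    · rw [hmax _ (S.edge_mem_faces p i) h]
      exact .inl (S.card_edge p i)
    · rw [hmax _ (S.triangle_mem_faces t) h]
      exact .inr (S.card_triangle t)

/-- Every tripartite triangle system is realized by a triangular configuration, with a given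
numbering of the edges and given weights. -/
theorem exists_triadjacency_eq [Finite V] [Fintype τ] [Nonempty τ] (wt : τ → ℕ) :
    ∃ (Δ : TriangularConfiguration) (E : Δ.Tripartition) (w : Δ.triangles → ℕ)
      (ν : ∀ p : Fin 3, Fin N ≃ E.part p), (∀ s, ∃ t, w s = wt t) ∧
      ∀ i j l, Δ.triadjacency E w ν i j l =
        ∑ t with S.inc 0 t = i ∧ S.inc 1 t = j ∧ S.inc 2 t = l, (Polynomial.X : ℕ[X]) ^ wt t := by
  classical
  have := Fintype.ofFinite V
  -- One dimension per vertex: with the vertices at the standard basis vectors, every abstract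
  -- complex is realized.
  let b := EuclideanSpace.basisFun (Fin (Fintype.card V)) ℝ
  let f : V ↪ EuclideanSpace ℝ (Fin (Fintype.card V)) :=
    (Fintype.equivFin V).toEmbedding.trans ⟨b, b.toBasis.linearIndependent.injective.comp
      (fun _ _ h => h) |> fun h => by simpa using h⟩
  have hP : AffineIndependent ℝ ((↑) : Set.range b → EuclideanSpace ℝ (Fin (Fintype.card V))) := by
    have := b.toBasis.linearIndependent.affineIndependent.range
    simpa using this
  let S' := S.map f
  have hSP : ∀ s ∈ S'.faces, (s : Set _) ⊆ Set.range b := by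
    rintro s ⟨-, ⟨p, i, h⟩ | ⟨t, h⟩⟩ x hx <;>
    · obtain ⟨v, -, rfl⟩ := Finset.mem_map.1 (h hx)
      exact ⟨Fintype.equivFin V v, rfl⟩
  let Δ := S'.toConfiguration hP hSP
  have htri : ∀ {s}, s ∈ Δ.triangles ↔ ∃ t, s = S'.triangle t := S'.mem_faces_card_three
  let E : Δ.Tripartition :=
    { part := fun p => Set.range (S'.edge p)
      iUnion_part := by
        ext s
        refine Iff.trans ?_ S'.mem_faces_card_two.symm
        simp only [Set.mem_iUnion]
        exact exists₂_congr fun _ _ => eq_comm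
      disjoint_part := fun p q hpq => Set.disjoint_left.2 <| by
        rintro _ ⟨i, rfl⟩ ⟨j, h⟩
        exact hpq (S'.edge_inj _ _ _ _ h).1.symm
      exists_edge := fun s hs p => by
        obtain ⟨t, rfl⟩ := htri.1 hs
        exact ⟨_, ⟨_, rfl⟩, S'.edge_subset p t⟩ }
  let w : Δ.triangles → ℕ := fun s => wt (htri.1 s.2).choose
  have hw : ∀ t (h : S'.triangle t ∈ Δ.triangles), w ⟨_, h⟩ = wt t := fun t h => by
    have := (htri.1 h).choose_spec
    exact congrArg wt (S'.triangle_injective this).symm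
  refine ⟨Δ, E, w, fun p => Equiv.ofInjective _ fun i j h => (S'.edge_inj p p i j h).2,
    fun s => ⟨_, rfl⟩, fun i j l => ?_⟩
  unfold TriangularConfiguration.triadjacency
  by_cases h : ∃ t, S.inc 0 t = i ∧ S.inc 1 t = j ∧ S.inc 2 t = l
  · obtain ⟨t, rfl, rfl, rfl⟩ := h
    have h0 : S'.edge 0 (S.inc 0 t) ∪ S'.edge 1 (S.inc 1 t) ∪ S'.edge 2 (S.inc 2 t) =
      S'.triangle t := S'.union_edge_eq t
    have h1 : (Finset.univ.filter fun t' => S.inc 0 t' = S.inc 0 t ∧ S.inc 1 t' = S.inc 1 t ∧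
        S.inc 2 t' = S.inc 2 t) = {t} := by
      ext t'
      simp only [Finset.mem_filter, Finset.mem_univ, true_and, Finset.mem_singleton]
      refine ⟨fun h => S.inc_inj _ _ fun p => ?_, by rintro rfl; simp⟩
      fin_cases p
      exacts [h.1, h.2.1, h.2.2]
    have h2 := htri.2 ⟨t, rfl⟩
    rw [h1, Finset.sum_singleton, ← hw t h2]
    refine (dif_pos (h0.symm ▸ h2 :)).trans ?_
    exact congrArg (fun s => (Polynomial.X : ℕ[X]) ^ w s) (Subtype.ext h0)
  · rw [dif_neg, Finset.sum_eq_zero]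
    · intro t ht
      exact absurd ⟨t, (Finset.mem_filter.1 ht).2⟩ h
    · intro h'
      obtain ⟨t, ht⟩ := htri.1 h'
      refine h ⟨t, ?_, ?_, ?_⟩ <;> refine (S'.eq_inc_of_subset (ht ▸ ?_)).symm
      · exact Finset.subset_union_left.trans Finset.subset_union_left
      · exact Finset.subset_union_right.trans Finset.subset_union_left
      · exact Finset.subset_union_right

end TriangleSystem

/-! ### Permanents and exact covers -/

/-- `M` is an exact cover: every element of each of the three families is incident with exactly one
member of `M`. -/
def IsExactCover {τ : Type*} {N : ℕ} (inc : Fin 3 → τ → Fin N) (M : Finset τ) : Prop :=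
  ∀ p i, ∃! t, t ∈ M ∧ inc p t = i

open Classical in
/-- The permanent of a 3-matrix of sums of powers is the generating function of exact covers. -/
theorem permanent3_eq_sum_exactCover {τ : Type*} [Fintype τ] {N : ℕ} (inc : Fin 3 → τ → Fin N)
    {R : Type*} [CommSemiring R] (x : τ → R) :
    permanent3 (fun i j l => ∑ t with inc 0 t = i ∧ inc 1 t = j ∧ inc 2 t = l, x t) =
      ∑ M : Finset τ with IsExactCover inc M, ∏ t ∈ M, x t := by
  unfold permanent3
  simp_rw [Finset.prod_sum, Finset.sum_sigma']
  symm
  have key : ∀ M, IsExactCover inc M → ∀ p, Function.Bijective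
      (fun t : M => inc p t) := fun M hM p => by
    refine ⟨fun t t' h => Subtype.ext ((hM p (inc p t)).unique ⟨t.2, rfl⟩ ⟨t'.2, h.symm⟩),
      fun i => ?_⟩
    obtain ⟨t, ht, -⟩ := hM p i
    exact ⟨⟨t, ht.1⟩, ht.2⟩
  let eqv : ∀ M, IsExactCover inc M → ∀ p, M ≃ Fin N := fun M hM p =>
    Equiv.ofBijective _ (key M hM p)
  have hcov : ∀ f ∈ (Finset.univ.sigma fun σ : Equiv.Perm (Fin N) =>
      Finset.univ.sigma fun σ' : Equiv.Perm (Fin N) => Finset.univ.pi fun i =>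
        Finset.univ.filter fun t => inc 0 t = i ∧ inc 1 t = σ i ∧ inc 2 t = σ' i),
      IsExactCover inc (Finset.univ.image fun i => f.2.2 i (Finset.mem_univ i)) := by
    intro f hf
    simp only [Finset.mem_sigma, Finset.mem_univ, true_and, Finset.mem_pi, Finset.mem_filter] at hf
    intro p
    have : ∃ σ : Equiv.Perm (Fin N), ∀ i, inc p (f.2.2 i (Finset.mem_univ i)) = σ i := by
      fin_cases p
      · exact ⟨Equiv.refl _, fun i => (hf i trivial).1⟩
      · exact ⟨f.1, fun i => (hf i trivial).2.1⟩
      · exact ⟨f.2.1, fun i => (hf i trivial).2.2⟩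
    obtain ⟨σ, hσ⟩ := this
    intro i
    refine ⟨f.2.2 (σ.symm i) (Finset.mem_univ _),
      ⟨Finset.mem_image_of_mem _ (Finset.mem_univ _), by rw [hσ, σ.apply_symm_apply]⟩, ?_⟩
    rintro t ⟨ht, rfl⟩
    obtain ⟨j, -, rfl⟩ := Finset.mem_image.1 ht
    have : σ.symm (inc p (f.2.2 j (Finset.mem_univ j))) = j := by rw [hσ, σ.symm_apply_apply]
    exact (congrArg (fun i => f.2.2 i (Finset.mem_univ i)) this).symm
  -- Numbering the members of a cover by their edges of family 0 turns their edges of families 1 and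
  -- 2 into the two permutations.
  refine Finset.sum_bij'
    (fun M hM => ⟨(eqv M (Finset.mem_filter.1 hM).2 0).symm.trans
        (eqv M (Finset.mem_filter.1 hM).2 1),
      (eqv M (Finset.mem_filter.1 hM).2 0).symm.trans (eqv M (Finset.mem_filter.1 hM).2 2),
      fun i _ => (eqv M (Finset.mem_filter.1 hM).2 0).symm i⟩)
    (fun f _ => Finset.univ.image fun i => f.2.2 i (Finset.mem_univ i)) ?_ ?_ ?_ ?_ ?_
  · intro M hM
    have hM := (Finset.mem_filter.1 hM).2
    simp only [Finset.mem_sigma, Finset.mem_univ, true_and, Finset.mem_pi, Finset.mem_filter]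
    intro i _
    refine ⟨?_, rfl, rfl⟩
    exact (eqv M hM 0).apply_symm_apply i
  · exact fun f hf => Finset.mem_filter.2 ⟨Finset.mem_univ _, hcov f hf⟩
  · intro M hM
    ext t
    simp only [Finset.mem_image, Finset.mem_univ, true_and]
    constructor
    · rintro ⟨i, rfl⟩
      exact Subtype.prop _
    · intro ht
      exact ⟨eqv M (Finset.mem_filter.1 hM).2 0 ⟨t, ht⟩, by simp⟩
  · rintro ⟨σ, σ', f⟩ hf
    have hf' := hf
    simp only [Finset.mem_sigma, Finset.mem_univ, true_and, Finset.mem_pi, Finset.mem_filter] at hf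
    have hsymm : ∀ (M) (hM : IsExactCover inc M) (t : M) (i), inc 0 t = i →
        (eqv M hM 0).symm i = t := by
      rintro M hM t i rfl
      exact (eqv M hM 0).symm_apply_apply t
    have h0 : ∀ (hM) i, (((eqv (Finset.univ.image fun i => f i (Finset.mem_univ i)) hM 0).symm i :
        _) : τ) = f i (Finset.mem_univ i) := fun hM i => congrArg Subtype.val (hsymm _ hM
          ⟨f i (Finset.mem_univ i), Finset.mem_image_of_mem _ (Finset.mem_univ _)⟩ i
          (hf i trivial).1)
    refine Sigma.ext ?_ (heq_of_eq (Sigma.ext ?_ (heq_of_eq ?_)))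
    · ext1 i
      refine (congrArg (inc 1) (h0 (hcov _ hf') i)).trans (hf i trivial).2.1
    · ext1 i
      refine (congrArg (inc 2) (h0 (hcov _ hf') i)).trans (hf i trivial).2.2
    · funext i _
      exact h0 (hcov _ hf') i
  · intro M hM
    rw [← Finset.prod_coe_sort M]
    refine (Fintype.prod_equiv (eqv M (Finset.mem_filter.1 hM).2 0) _ _ fun t => ?_).trans
      (Finset.prod_attach Finset.univ fun i => x ((eqv M (Finset.mem_filter.1 hM).2 0).symm i)).symm
    simp

/-! ### The triangle system of a grid

The cells of a cyclic `r × m` grid contain nine edges of each family and 23 kinds of triangles. The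
triangles `0`, ..., `3` of a row form a double pyramid; an exact cover uses its white triangles `1`
and `2` or its black ones, and so chooses a bit of the message. Every cell has a row node, the
boundary of the triangle `0`, and a column node, the triangle `4`. The triangles `5`, ..., `10`,
the triangles `11`, ..., `16` and the triangles `17`, ..., `22` form octahedra without two faces,
each of which covers two nodes or none: the row and the column node, the row node and the next
column node, and the two column nodes. They compute the parity checks of the columns. -/

namespace Grid

/-- The local name of the edge of the `p`-th family in a triangle of the given kind. -/
def loc : Fin 3 → Fin 23 → Fin 9 :=
  ![![0, 0, 1, 1, 2, 0, 2, 4, 3, 3, 4, 0, 2, 6, 5, 5, 6, 2, 2, 8, 7, 7, 8],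
    ![0, 0, 1, 1, 2, 3, 4, 0, 2, 4, 3, 5, 6, 0, 2, 6, 5, 7, 8, 2, 2, 8, 7],
    ![0, 1, 0, 1, 2, 3, 4, 2, 0, 3, 4, 5, 6, 2, 0, 5, 6, 7, 8, 2, 2, 7, 8]]

/-- The cell of the edge of the `p`-th family in a triangle of the given kind, relative to the cell
of the triangle: `0` is the same cell, `1` the next one in the row, `2` the next one in the
column. -/
def sh : Fin 3 → Fin 23 → Fin 3 :=
  ![![0, 0, 0, 0, 0, 0, 0, 0, 0, 0, 0, 0, 2, 0, 0, 0, 0, 0, 2, 0, 0, 0, 0],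
    ![0, 1, 0, 1, 0, 0, 0, 0, 0, 0, 0, 0, 0, 0, 2, 0, 0, 0, 0, 0, 2, 0, 0],
    ![0, 0, 0, 0, 0, 0, 0, 0, 0, 0, 0, 0, 0, 2, 0, 0, 0, 0, 0, 2, 0, 0, 0]]

/-- Different triangles thus occupy different positions of the 3-matrix, so no entry is a proper
sum. -/
theorem loc_injective : ∀ κ κ', (∀ p, loc p κ = loc p κ') → κ = κ' := by decide

variable {r m : ℕ}

/-- The number of the edge with local name `l` in the cell `c`. -/
def idx (l : Fin 9) (c : Fin r × Fin m) : Fin (9 * (r * m)) :=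
  finProdFinEquiv (l, finProdFinEquiv c)

theorem idx_inj {l l' : Fin 9} {c c' : Fin r × Fin m} : idx l c = idx l' c' ↔ l = l' ∧ c = c' := by
  simp [idx]

variable [NeZero r] [NeZero m]

/-- The moves on a cyclic grid. -/
def move : Fin 3 → Equiv.Perm (Fin r × Fin m) :=
  ![Equiv.refl _, (Equiv.refl _).prodCongr (Equiv.addRight 1),
    (Equiv.addRight 1).prodCongr (Equiv.refl _)]

/-- The edges of the triangles of the grid. -/
def inc (p : Fin 3) (t : Fin 23 × (Fin r × Fin m)) : Fin (9 * (r * m)) :=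
  idx (loc p t.1) (move (sh p t.1) t.2)

theorem inc_inj (t t' : Fin 23 × (Fin r × Fin m)) (h : ∀ p, inc p t = inc p t') : t = t' := by
  obtain ⟨κ, c⟩ := t
  obtain ⟨κ', c'⟩ := t'
  have h' := fun p => idx_inj.1 (h p)
  obtain rfl := loc_injective κ κ' fun p => (h' p).1
  exact congrArg _ ((move (sh 0 κ)).injective (h' 0).2)

/-- The incidence of a set of triangles with an edge. -/
def cover (χ : Fin 23 → Fin r × Fin m → ℕ) (p : Fin 3) (l : Fin 9) (c : Fin r × Fin m) : ℕ :=
  ∑ κ, if loc p κ = l then χ κ ((move (sh p κ)).symm c) else 0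

theorem isExactCover_iff (M : Finset (Fin 23 × (Fin r × Fin m))) :
    IsExactCover inc M ↔ ∀ p l c, cover (fun κ c => if (κ, c) ∈ M then 1 else 0) p l c = 1 := by
  have h : ∀ p l c, (∃! t, t ∈ M ∧ inc p t = idx l c) ↔
      cover (fun κ c => if (κ, c) ∈ M then 1 else 0) p l c = 1 := fun p l c => by
    rw [Fintype.existsUnique_iff_card_one, Finset.card_filter, Fintype.sum_prod_type, cover]
    refine Eq.congr_left (Finset.sum_congr rfl fun κ _ => ?_)
    simp only [inc, idx_inj]
    split_ifs with hl hM
    · rw [Finset.sum_eq_single ((move (sh p κ)).symm c)]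
      · simp [hl, hM]
      · rintro c' - hc
        rw [if_neg]
        rintro ⟨-, -, rfl⟩
        simp at hc
      · simp
    · refine Finset.sum_eq_zero fun c' _ => if_neg ?_
      rintro ⟨hM', -, rfl⟩
      simp [hM'] at hM
    · exact Finset.sum_eq_zero fun c' _ => if_neg fun h => hl h.2.1
  refine forall_congr' fun p => ⟨fun H l c => (h p l c).1 (H _), fun H i => ?_⟩
  have : i = idx (finProdFinEquiv.symm i).1 (finProdFinEquiv.symm (finProdFinEquiv.symm i).2) := by
    simp only [idx, Prod.mk.eta, Equiv.apply_symm_apply]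
  rw [this]
  exact (h p _ _).2 (H _ _)

/-- The values of the six independent triangles of a cell in an exact cover. -/
structure Bits where
  /-- the bit of the row -/
  white : ℕ
  /-- the triangle at the row node -/
  own : ℕ
  /-- the triangle at the column node -/
  final : ℕ
  /-- the gadget joining the row node to the column node of the cell -/
  p : ℕ
  /-- the gadget joining the row node to the next column node -/
  q : ℕ
  /-- the gadget joining two consecutive column nodes -/
  r : ℕ

/-- The values of all triangles of a cell in terms of the independent ones. -/
def pattern (b : Bits) : Fin 23 → ℕ :=
  ![b.own, b.white, b.white, 1 - b.white, b.final,
    b.p, b.p, b.p, b.p, 1 - b.p, 1 - b.p,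
    b.q, b.q, b.q, b.q, 1 - b.q, 1 - b.q,
    b.r, b.r, b.r, b.r, 1 - b.r, 1 - b.r]

/-- Most edges lie in only two triangles, and these equations tie each gadget and each row ring to a
single bit. What remains is one equation per row node and one per column node. -/
theorem cover_eq_one_iff (χ : Fin 23 → Fin r × Fin m → ℕ) (hχ : ∀ κ c, χ κ c ≤ 1) :
    (∀ p l c, cover χ p l c = 1) ↔
      (∀ κ c, χ κ c = pattern ⟨χ 2 c, χ 0 c, χ 4 c, χ 5 c, χ 11 c, χ 17 c⟩ κ) ∧
      (∀ i j, χ 2 (i, j + 1) = χ 2 (i, j)) ∧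
      (∀ c, χ 0 c + χ 2 c + χ 5 c + χ 11 c = 1) ∧
      ∀ i j, χ 4 (i + 1, j) + χ 5 (i + 1, j) + χ 17 (i + 1, j) + χ 11 (i, j) + χ 17 (i, j) = 1 := by
  constructor
  · intro H
    have hpat : ∀ κ c, χ κ c = pattern ⟨χ 2 c, χ 0 c, χ 4 c, χ 5 c, χ 11 c, χ 17 c⟩ κ := by
      rintro κ ⟨i, j⟩
      have h := fun p l => H p l (i, j)
      -- These are edges 1 of families 0 and 2 and the six inner edges of each gadget. Each lies in
      -- two triangles of the cell, of which a cover takes exactly one.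
      have a0 := h 0 1
      have a1 := h 2 1
      have a2 := h 0 3
      have a3 := h 0 4
      have a4 := h 1 3
      have a5 := h 1 4
      have a6 := h 2 3
      have a7 := h 2 4
      have b2 := h 0 5
      have b3 := h 0 6
      have b4 := h 1 5
      have b5 := h 1 6
      have b6 := h 2 5
      have b7 := h 2 6
      have c2 := h 0 7
      have c3 := h 0 8
      have c4 := h 1 7
      have c5 := h 1 8
      have c6 := h 2 7
      have c7 := h 2 8
      simp [cover, Fin.sum_univ_ofNat, loc, sh, move] at a0 a1 a2 a3 a4 a5 a6 a7
      simp [cover, Fin.sum_univ_ofNat, loc, sh, move] at b2 b3 b4 b5 b6 b7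
      simp [cover, Fin.sum_univ_ofNat, loc, sh, move] at c2 c3 c4 c5 c6 c7
      fin_cases κ <;> simp [pattern] <;> omega
    refine ⟨hpat, fun i j => ?_, ?_, fun i j => ?_⟩
    -- Edge 1 of family 1 is shared with the triangle 3 of the preceding cell, which carries the bit
    -- along the row.
    · have a0 := H 1 1 (i, j + 1)
      have a1 := H 0 1 (i, j)
      simp [cover, Fin.sum_univ_ofNat, loc, sh, move] at a0 a1
      omega
    · rintro ⟨i, j⟩
      have a0 := H 0 0 (i, j)
      have a1 := hpat 1 (i, j)
      simp [cover, Fin.sum_univ_ofNat, loc, sh, move] at a0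
      simp [pattern] at a1
      omega
    · have a0 := H 0 2 (i + 1, j)
      have a1 := hpat 6 (i + 1, j)
      have a2 := hpat 12 (i, j)
      have a3 := hpat 18 (i, j)
      simp [cover, Fin.sum_univ_ofNat, loc, sh, move] at a0
      simp [pattern] at a1 a2 a3
      omega
  · rintro ⟨hpat, hrow, hX, hS⟩ p l ⟨i, j⟩
    have hX0 := hX (i, j)
    have hrow0 := hrow i (j + -1)
    have hS0 := hS (i + -1) j
    rw [neg_add_cancel_right] at hrow0 hS0
    have b1 := hχ 2 (i, j)
    have b2 := hχ 5 (i, j)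
    have b3 := hχ 11 (i, j)
    have b4 := hχ 17 (i, j)
    fin_cases p <;> fin_cases l <;>
      simp [cover, Fin.sum_univ_ofNat, loc, sh, move, hpat 1, hpat 3, hpat 6, hpat 7, hpat 8,
        hpat 9, hpat 10, hpat 12, hpat 13, hpat 14, hpat 15, hpat 16, hpat 18, hpat 19, hpat 20,
        hpat 21, hpat 22] <;> simp only [pattern] <;> simp <;> omega

/-! ### Exact covers of the grid and codewords -/

section

variable {k n : ℕ} (G : Matrix (Fin k) (Fin n) (ZMod 2)) (u : Fin k → ZMod 2)

/-- The matrix, extended by zeros. -/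
def extMat (i j : ℕ) : ZMod 2 := if h : i < k ∧ j < n then G ⟨i, h.1⟩ ⟨j, h.2⟩ else 0

/-- The message, extended by zeros. -/
def extVec (i : ℕ) : ZMod 2 := if h : i < k then u ⟨i, h⟩ else 0

/-- The states of the parity check of the `j`-th column. -/
def checkState (j : ℕ) : ℕ → ZMod 2
  | 0 => 0
  | i + 1 => checkState j i + 1 + extMat G i j * extVec u i

/-- The summand `i` counts the flips made even where nothing is added; this is why the parity of the
number of rows matters. -/
theorem checkState_eq (j i : ℕ) :
    checkState G u j i = i + ∑ x ∈ Finset.range i, extMat G x j * extVec u x := by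
  induction i with
  | zero => simp [checkState]
  | succ i ih =>
    rw [checkState, ih, Finset.sum_range_succ]
    push_cast
    ring

theorem sum_extMat_mul_extVec {i : ℕ} (hi : k ≤ i) (j : ℕ) :
    ∑ x ∈ Finset.range i, extMat G x j * extVec u x =
      if h : j < n then (Matrix.vecMul u G) ⟨j, h⟩ else 0 := by
  rw [← Finset.sum_subset (Finset.range_subset_range.2 hi), Finset.sum_range]
  · split_ifs with h
    · refine Finset.sum_congr rfl fun x _ => ?_
      simp [extMat, extVec, h, mul_comm]
    · exact Finset.sum_eq_zero fun x _ => by simp [extMat, h]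
  · intro x _ hx
    simp only [Finset.mem_range, not_lt] at hx
    simp [extMat, hx.not_gt]

variable (r : ℕ)

/-- The entries of the 3-matrix: `0` for an absent triangle, and one more than its weight for one
that is present. -/
def code (i j : ℕ) : Fin 23 → ℕ :=
  ![1 - (extMat G i j).val, 1, 1, if i < k then 1 else 0, if i + 1 = r then 3 else 0,
    (extMat G i j).val, 1, 1, 1, 1, 1,
    (extMat G i j).val, 1, 1, 1, 1, 1,
    if i + 1 = r then 0 else 1, 1, 1, 1, 1, 1]

/-- The bits of the exact cover of a message. -/
def bits (i j : ℕ) : Bits where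
  white := if extVec u i = 0 then 1 else 0
  own := if extMat G i j = 0 ∧ extVec u i ≠ 0 then 1 else 0
  final := if i + 1 = r ∧ checkState G u j i = 0 then 1 else 0
  p := if extMat G i j ≠ 0 ∧ extVec u i ≠ 0 ∧ checkState G u j i = 0 then 1 else 0
  q := if extMat G i j ≠ 0 ∧ extVec u i ≠ 0 ∧ checkState G u j i ≠ 0 then 1 else 0
  r := if i + 1 ≠ r ∧ checkState G u j i = 0 ∧ (extVec u i = 0 ∨ extMat G i j = 0) then 1 else 0

theorem pattern_le_one (b : Bits) (h : b.white ≤ 1 ∧ b.own ≤ 1 ∧ b.final ≤ 1 ∧ b.p ≤ 1 ∧ b.q ≤ 1 ∧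
    b.r ≤ 1) (κ : Fin 23) : pattern b κ ≤ 1 := by
  fin_cases κ <;> simp [pattern, h]

theorem pattern_eta (b : Bits) :
    pattern ⟨pattern b 2, pattern b 0, pattern b 4, pattern b 5, pattern b 11, pattern b 17⟩ =
      pattern b := by
  simp [pattern]

theorem pattern_bits_le_one (i j : ℕ) (κ : Fin 23) : pattern (bits G u r i j) κ ≤ 1 := by
  apply pattern_le_one
  simp only [bits]
  refine ⟨?_, ?_, ?_, ?_, ?_, ?_⟩ <;> split_ifs <;> simp

theorem lt_of_extVec_ne_zero {i : ℕ} (h : extVec u i ≠ 0) : i < k := by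
  by_contra hi
  exact h (dif_neg hi)

theorem zmod_two_cases : ∀ x : ZMod 2, x = 0 ∨ x = 1 := by decide

theorem zmod_two_val_one : (1 : ZMod 2).val = 1 := rfl

/-- The cover of a message uses only triangles that are present, so its term in the permanent does
not vanish. -/
theorem code_ne_zero {i j : ℕ} {κ : Fin 23} (h : pattern (bits G u r i j) κ = 1) :
    code G r i j κ ≠ 0 := by
  have hu := lt_of_extVec_ne_zero u (i := i)
  revert h
  rcases zmod_two_cases (extMat G i j) with hg | hg <;> by_cases hv : extVec u i = 0 <;>
  fin_cases κ <;> simp [pattern, code, bits, hg, hv, zmod_two_val_one] <;> tauto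

theorem extMat_eq_zero {i j : ℕ} (h : k ≤ i) : extMat G i j = 0 := dif_neg fun h' => h.not_gt h'.1

/-- The nodes of a cell determine its bits. -/
theorem bits_unique {i j : ℕ} {w o t p q e : ℕ} (hz : i + 1 = r → k ≤ i)
    (hw : w = if extVec u i = 0 then 1 else 0)
    (hX : o + w + p + q = 1)
    (hS : t + p + e + (if checkState G u j i ≠ 0 then 1 else 0) = 1) (hD : q + e ≤ 1)
    (ho : extMat G i j ≠ 0 → o = 0) (hpq : extMat G i j = 0 → p = 0 ∧ q = 0)
    (ht : i + 1 ≠ r → t = 0) (he : i + 1 = r → e = 0) :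
    (⟨w, o, t, p, q, e⟩ : Bits) = bits G u r i j := by
  have hg : i + 1 = r → extMat G i j = 0 := fun h => extMat_eq_zero G (hz h)
  simp only [bits, Bits.mk.injEq]
  -- If the matrix entry and the bit are 1 and the state is 0, the two node equations also allow `q
  -- = e = 1` with `p = 0`; `hD` excludes this, since the next column node would be covered twice.
  by_cases h1 : extMat G i j = 0 <;> by_cases h2 : extVec u i = 0 <;>
  by_cases h3 : checkState G u j i = 0 <;> by_cases h4 : i + 1 = r <;>
  simp [h1, h2, h3, h4] at hw hX hS hg ho hpq ht he ⊢ <;> omega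

theorem bits_eq_one {i j : ℕ} (hz : i + 1 = r → k ≤ i) :
    (bits G u r i j).own + (bits G u r i j).white + (bits G u r i j).p + (bits G u r i j).q = 1 ∧
    (bits G u r i j).final + (bits G u r i j).p + (bits G u r i j).r +
      (if checkState G u j i ≠ 0 then 1 else 0) = 1 := by
  have hg : i + 1 = r → extMat G i j = 0 := fun h => extMat_eq_zero G (hz h)
  simp only [bits]
  by_cases h1 : extMat G i j = 0 <;> by_cases h2 : extVec u i = 0 <;>
  by_cases h3 : checkState G u j i = 0 <;> by_cases h4 : i + 1 = r <;>
  simp [h1, h2, h3, h4] at hg ⊢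

/-- The gadgets leaving a cell downwards realize the recursion of `checkState`: an uncovered next
node means state 0. -/
theorem bits_q_add_r {i j : ℕ} (h : i + 1 ≠ r) :
    (bits G u r i j).q + (bits G u r i j).r =
      if checkState G u j (i + 1) ≠ 0 then 1 else 0 := by
  simp only [bits, checkState]
  rcases zmod_two_cases (extMat G i j) with h1 | h1 <;>
  rcases zmod_two_cases (extVec u i) with h2 | h2 <;>
  rcases zmod_two_cases (checkState G u j i) with h3 | h3 <;>
  simp [h1, h2, h3, h] <;> decide

end

/-! ### Exact covers avoiding absent triangles correspond to messages -/

section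

variable {k n r m : ℕ} (G : Matrix (Fin k) (Fin n) (ZMod 2))

/-- The exact cover of a message. -/
def chosen (u : Fin k → ZMod 2) : Finset (Fin 23 × (Fin r × Fin m)) :=
  {t | pattern (bits G u r t.2.1 t.2.2) t.1 = 1}

theorem mem_chosen {u : Fin k → ZMod 2} {κ : Fin 23} {c : Fin r × Fin m} :
    (κ, c) ∈ chosen G u ↔ pattern (bits G u r c.1 c.2) κ = 1 := by
  simp only [chosen, Finset.mem_filter, Finset.mem_univ, true_and]

theorem chi_chosen (u : Fin k → ZMod 2) (κ : Fin 23) (c : Fin r × Fin m) :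
    (if (κ, c) ∈ chosen G u then 1 else 0) = pattern (bits G u r c.1 c.2) κ := by
  have := pattern_bits_le_one G u r c.1 c.2 κ
  simp only [chosen, Finset.mem_filter, Finset.mem_univ, true_and]
  split_ifs <;> omega

theorem val_add_one_cases [NeZero r] (i : Fin r) :
    (i.val + 1 = r ∧ (i + 1).val = 0) ∨ (i.val + 1 ≠ r ∧ (i + 1).val = i.val + 1) := by
  obtain ⟨r, rfl⟩ := Nat.exists_eq_succ_of_ne_zero (NeZero.ne r)
  rw [Fin.val_add_one]
  split_ifs with h
  · subst h
    simp
  · refine .inr ⟨fun h' => h (Fin.ext ?_), rfl⟩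
    rw [Fin.val_last]
    omega

/-- The node equations hold cell by cell. At the cyclic seam, the last row sends nothing down, which
agrees with the initial state 0. -/
theorem isExactCover_chosen [NeZero r] [NeZero m] (hk : k < r) (u : Fin k → ZMod 2) :
    IsExactCover inc (chosen (r := r) (m := m) G u) := by
  rw [isExactCover_iff]
  simp_rw [chi_chosen]
  rw [cover_eq_one_iff _ fun κ c => pattern_bits_le_one G u r _ _ κ]
  refine ⟨fun κ c => by rw [pattern_eta], fun i j => by simp [pattern, bits], fun c => ?_,
    fun i j => ?_⟩
  · simpa [pattern] using (bits_eq_one G u r (i := c.1) (j := c.2) (by omega)).1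
  · have h := (bits_eq_one G u r (i := (i + 1 : Fin r)) (j := j) (by omega)).2
    simp only [pattern]
    simp
    rcases val_add_one_cases i with ⟨h1, h2⟩ | ⟨h1, h2⟩
    · have h3 : (bits G u r i j).q = 0 := by
        simp [bits, extMat_eq_zero G (show k ≤ i by omega)]
      have h4 : (bits G u r i j).r = 0 := by simp [bits, h1]
      rw [h2] at h ⊢
      simp only [checkState, ne_eq, not_true_eq_false, if_false] at h
      omega
    · have h3 := bits_q_add_r G u r (i := i) (j := j) h1
      rw [h2] at h ⊢
      omega

/-- The message can be read off from the triangles 2 in column 0. -/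
theorem chosen_injective [NeZero m] (hk : k < r) :
    Function.Injective (chosen (r := r) (m := m) G) := by
  intro u u' h
  funext x
  have := chi_chosen G u 2 ((⟨x, x.2.trans hk⟩ : Fin r), (0 : Fin m))
  rw [h, chi_chosen] at this
  simp [pattern, bits, extVec] at this
  rcases zmod_two_cases (u x) with h1 | h1 <;> rcases zmod_two_cases (u' x) with h2 | h2 <;>
    simp [h1, h2] at this ⊢

/-- The weight of a triangle as an entry of the 3-matrix. -/
noncomputable def entry (t : Fin 23 × (Fin r × Fin m)) : ℕ[X] :=
  if code G r t.2.1 t.2.2 t.1 = 0 then 0 else Polynomial.X ^ (code G r t.2.1 t.2.2 t.1 - 1)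

/-- Only triangles 4 of the last row have positive weight, and column `j` uses its one exactly if
its final state is 0. -/
theorem sum_weight_chosen (hk : k < r) (hm : n ≤ m) (hr : Even r) (u : Fin k → ZMod 2) :
    ∑ t ∈ chosen (r := r) (m := m) G u, (code G r t.2.1 t.2.2 t.1 - 1) =
      2 * hammingNorm (Matrix.vecMul u G) := by
  have hr0 : 0 < r := by omega
  have h1 : ∀ κ (c : Fin r × Fin m),
      (if (κ, c) ∈ chosen G u then code G r c.1 c.2 κ - 1 else 0) =
        if κ = 4 ∧ c.1.val + 1 = r ∧ checkState G u c.2 c.1 = 0 then 2 else 0 := by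
    intro κ c
    have hv : (extMat G c.1 c.2).val - 1 = 0 := by
      have := ZMod.val_lt (extMat G c.1 c.2)
      omega
    by_cases hκ : κ = 4
    · subst hκ
      have h2 : (4, c) ∈ chosen G u ↔ c.1.val + 1 = r ∧ checkState G u c.2 c.1 = 0 := by
        simp [mem_chosen, pattern, bits]
      simp only [h2, true_and]
      refine if_ctx_congr Iff.rfl (fun h => ?_) fun _ => rfl
      simp [code, h.1]
    · have : code G r c.1 c.2 κ - 1 = 0 := by
        fin_cases κ <;> simp [code, hv] at hκ ⊢ <;> split_ifs <;> simp
      rw [this, ite_self, if_neg fun h => hκ h.1]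
  have h2 : ∑ t ∈ chosen (r := r) (m := m) G u, (code G r t.2.1 t.2.2 t.1 - 1) =
      ∑ j : Fin m, if checkState G u j (r - 1) = 0 then 2 else 0 := by
    rw [← Finset.univ_inter (chosen G u), ← Finset.sum_ite_mem, Fintype.sum_prod_type]
    simp only [h1]
    rw [Finset.sum_eq_single 4 (fun κ _ h => Finset.sum_eq_zero fun c _ => if_neg fun h' => h h'.1)
      (by simp), Fintype.sum_prod_type, Finset.sum_eq_single ⟨r - 1, by omega⟩]
    · simp [Nat.sub_add_cancel hr0]
    · intro i _ hi
      refine Finset.sum_eq_zero fun j _ => if_neg fun h => hi (Fin.ext ?_)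
      have := h.2.1
      simp only at this ⊢
      omega
    · simp
  let g : ℕ → ℕ := fun j => if h : j < n then if Matrix.vecMul u G ⟨j, h⟩ ≠ 0 then 2 else 0 else 0
  have h3 : ∀ j, (if checkState G u j (r - 1) = 0 then 2 else 0) = g j := fun j => by
    -- Because `r - 1` is odd, the final state is one plus the coordinate of the codeword, so state
    -- 0 marks a non-zero coordinate.
    have h4 : ((r - 1 : ℕ) : ZMod 2) = 1 := by
      rw [ZMod.natCast_eq_one_iff_odd]
      exact Nat.Even.sub_odd hr0 hr odd_one
    rw [checkState_eq, sum_extMat_mul_extVec G u (by omega), h4]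
    simp only [g]
    by_cases h5 : j < n
    · simp only [dif_pos h5]
      rcases zmod_two_cases (Matrix.vecMul u G ⟨j, h5⟩) with h | h <;> rw [h] <;> decide
    · simp [dif_neg h5]
  rw [h2]
  simp only [h3]
  rw [Fin.sum_univ_eq_sum_range, ← Finset.sum_subset (Finset.range_subset_range.2 hm),
    Finset.sum_range]
  · simp [g, hammingNorm, Finset.sum_ite, mul_comm]
  · intro j _ hj
    exact dif_neg (by simpa using hj)

variable [NeZero r] [NeZero m]

-- Induction down each column: the state on arrival and the node equations determine the bits of a
-- cell by `bits_unique`, and these give the state on arrival at the next row by `bits_q_add_r`.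
open Fin.NatCast in
theorem exists_eq_chosen (hk : k < r) {M : Finset (Fin 23 × (Fin r × Fin m))}
    (hM : IsExactCover inc M) (hcode : ∀ κ c, (κ, c) ∈ M → code G r c.1 c.2 κ ≠ 0) :
    ∃ u, M = chosen G u := by
  let χ : Fin 23 → Fin r × Fin m → ℕ := fun κ c => if (κ, c) ∈ M then 1 else 0
  have hχ : ∀ κ c, χ κ c ≤ 1 := fun κ c => by
    simp only [χ]
    split_ifs <;> simp
  have hχ0 : ∀ κ c, code G r c.1 c.2 κ = 0 → χ κ c = 0 := fun κ c h =>
    if_neg fun h' => hcode κ c h' h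
  obtain ⟨hpat, hrow, hX, hS⟩ := (cover_eq_one_iff χ hχ).1 ((isExactCover_iff M).1 hM)
  have hrow' : ∀ i j, χ 2 (i, j) = χ 2 (i, 0) := fun i j => by
    have : ∀ x : ℕ, χ 2 (i, (x : Fin m)) = χ 2 (i, 0) := fun x => by
      induction x with
      | zero => simp
      | succ x ih => rw [Nat.cast_succ, hrow, ih]
    rw [← this j, Fin.cast_val_eq_self]
  let u : Fin k → ZMod 2 := fun x =>
    if χ 2 (⟨x, x.2.trans hk⟩, (0 : Fin m)) = 1 then 0 else 1
  have hwhite : ∀ i j, χ 2 (i, j) = if extVec u i = 0 then 1 else 0 := fun i j => by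
    rw [hrow']
    by_cases hi : i.val < k
    · have := hχ 2 (i, 0)
      have hu : extVec u i = if χ 2 (i, 0) = 1 then 0 else 1 := dif_pos hi
      rw [hu]
      by_cases h1 : χ 2 (i, 0) = 1
      · simp [h1]
      · rw [if_neg h1, if_neg one_ne_zero]
        omega
    -- Rows beyond the matrix lack the triangle 3, so they are white.
    · have h3 := hpat 3 (i, 0)
      rw [hχ0 3 _ (by simp [code, hi])] at h3
      have := hχ 2 (i, 0)
      simp [pattern] at h3
      simp only [extVec, hi, dif_neg, not_false_eq_true, if_true]
      omega
  have hcell : ∀ (i : ℕ) (hi : i < r) (j : Fin m),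
      χ 4 (⟨i, hi⟩, j) + χ 5 (⟨i, hi⟩, j) + χ 17 (⟨i, hi⟩, j) +
        (if checkState G u j i ≠ 0 then 1 else 0) = 1 →
      (⟨χ 2 (⟨i, hi⟩, j), χ 0 (⟨i, hi⟩, j), χ 4 (⟨i, hi⟩, j), χ 5 (⟨i, hi⟩, j), χ 11 (⟨i, hi⟩, j),
        χ 17 (⟨i, hi⟩, j)⟩ : Bits) = bits G u r i j := fun i hi j h => by
    refine bits_unique G u r (by omega) (hwhite _ _) (hX _) h ?_ ?_ ?_ ?_ ?_
    · have := hS ⟨i, hi⟩ j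
      omega
    · intro hg
      refine hχ0 _ _ ?_
      have := (zmod_two_cases (extMat G i j)).resolve_left hg
      simp [code, this, zmod_two_val_one]
    · intro hg
      exact ⟨hχ0 _ _ (by simp [code, hg]), hχ0 _ _ (by simp [code, hg])⟩
    · intro h
      exact hχ0 _ _ (by simp [code, h])
    · intro h
      exact hχ0 _ _ (by simp [code, h])
  have hstate : ∀ (i : ℕ) (hi : i < r) (j : Fin m),
      χ 4 (⟨i, hi⟩, j) + χ 5 (⟨i, hi⟩, j) + χ 17 (⟨i, hi⟩, j) +
        (if checkState G u j i ≠ 0 then 1 else 0) = 1 := fun i => by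
    induction i with
    | zero =>
      intro hi j
      -- The cyclic predecessor of row 0 is the last row, where kinds 11 and 17 are absent.
      let l : Fin r := ⟨r - 1, by omega⟩
      have hl : l.val + 1 = r := by simp only [l]; omega
      have h0 : l + 1 = ⟨0, hi⟩ := by
        rcases val_add_one_cases l with h | h
        · exact Fin.ext h.2
        · exact absurd hl h.1
      have h1 := hS l j
      rw [h0, hχ0 11 (l, j) (by simp [code, extMat_eq_zero G (show k ≤ l by omega)]),
        hχ0 17 (l, j) (by simp [code, hl])] at h1
      simpa [checkState] using h1
    | succ i ih =>
      intro hi j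
      have hi' : i < r := by omega
      have h0 : (⟨i, hi'⟩ + 1 : Fin r) = ⟨i + 1, hi⟩ := by
        rcases val_add_one_cases ⟨i, hi'⟩ with h | h
        · simp at h; omega
        · exact Fin.ext h.2
      have h1 := hS ⟨i, hi'⟩ j
      have h2 := hcell i hi' j (ih hi' j)
      rw [← bits_q_add_r G u r (i := i) (j := j) (by omega), ← h2, ← h0]
      simpa only [add_assoc] using h1
  refine ⟨u, Finset.ext fun ⟨κ, i, j⟩ => ?_⟩
  have h1 := hpat κ (i, j)
  rw [hcell i i.2 j (hstate i i.2 j)] at h1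
  simp only [chosen, Finset.mem_filter, Finset.mem_univ, true_and, ← h1, χ]
  simp

/-- The permanent of the grid is the weight enumerator of the code, in `x ^ 2`. -/
theorem permanent3_entry (hk : k < r) (hm : n ≤ m) (hr : Even r) :
    permanent3 (fun i j l => ∑ t with inc 0 t = i ∧ inc 1 t = j ∧ inc 2 t = l,
      entry (r := r) (m := m) G t) =
      ∑ u : Fin k → ZMod 2, Polynomial.X ^ (2 * hammingNorm (Matrix.vecMul u G)) := by
  classical
  rw [permanent3_eq_sum_exactCover]
  symm
  refine Finset.sum_of_injOn (chosen G) (chosen_injective G hk).injOn ?_ ?_ ?_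
  · intro u _
    simpa using isExactCover_chosen G hk u
  · intro M hM hne
    -- A cover that comes from no message uses an absent triangle, whose entry 0 kills the product.
    obtain ⟨κ, c, ht, h0⟩ : ∃ κ c, (κ, c) ∈ M ∧ code G r c.1 c.2 κ = 0 := by
      by_contra! h
      obtain ⟨u, rfl⟩ := exists_eq_chosen G hk (Finset.mem_filter.1 hM).2 h
      exact hne ⟨u, by simp, rfl⟩
    exact Finset.prod_eq_zero ht (if_pos h0)
  · intro u _
    rw [← sum_weight_chosen G hk hm hr u, ← Finset.prod_pow_eq_pow_sum]
    refine Finset.prod_congr rfl fun t ht => (if_neg ?_).symm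
    exact code_ne_zero G u r (Finset.mem_filter.1 ht).2

end

/-! ### The vertices of the grid -/

section

variable {r m : ℕ} [NeZero r] [NeZero m]

/-- The vertex with the given name in a cell. The vertices named `0` depend on the column only, and
those named `6` and `7` on the row only. -/
def vert (l : Fin 9) (c : Fin r × Fin m) : Fin 9 × (Fin r × Fin m) :=
  (l, if l = 0 then (0, c.2) else if l = 6 ∨ l = 7 then (c.1, 0) else c)

/-- The first end of an edge of a cell. -/
def fstEnd (p : Fin 3) (l : Fin 9) (c : Fin r × Fin m) : Fin 9 × (Fin r × Fin m) :=
  vert ((![![4, 4, 5, 4, 5, 4, 5, 5, 5], ![0, 0, 0, 1, 1, 2, 2, 3, 3],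
      ![0, 0, 0, 1, 1, 2, 2, 3, 3]] : Fin 3 → Fin 9 → Fin 9) p l)
    (move ((![![0, 0, 0, 0, 0, 0, 2, 0, 2], ![0, 0, 0, 0, 0, 0, 0, 0, 0],
      ![0, 1, 0, 0, 0, 0, 0, 0, 0]] : Fin 3 → Fin 9 → Fin 3) p l) c)

/-- The second end of an edge of a cell. -/
def sndEnd (p : Fin 3) (l : Fin 9) (c : Fin r × Fin m) : Fin 9 × (Fin r × Fin m) :=
  vert ((![![6, 7, 8, 8, 6, 8, 6, 8, 8], ![6, 7, 8, 6, 8, 6, 8, 8, 8],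
      ![4, 4, 5, 4, 5, 4, 5, 5, 5]] : Fin 3 → Fin 9 → Fin 9) p l)
    (move ((![![0, 0, 0, 0, 0, 2, 0, 2, 0], ![0, 0, 0, 0, 0, 0, 2, 0, 2],
      ![0, 0, 0, 0, 0, 0, 2, 0, 2]] : Fin 3 → Fin 9 → Fin 3) p l) c)

/-- The corners of a triangle of a cell. -/
def corner (x : Fin 3) (t : Fin 23 × (Fin r × Fin m)) : Fin 9 × (Fin r × Fin m) :=
  vert ((![![0, 0, 0, 0, 0, 1, 1, 0, 0, 1, 1, 2, 2, 0, 0, 2, 2, 3, 3, 0, 0, 3, 3],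
      ![4, 4, 4, 4, 5, 4, 5, 5, 4, 4, 5, 4, 5, 5, 4, 4, 5, 5, 5, 5, 5, 5, 5],
      ![6, 6, 7, 7, 8, 6, 8, 6, 8, 8, 6, 6, 8, 6, 8, 8, 6, 8, 8, 8, 8, 8, 8]] :
        Fin 3 → Fin 23 → Fin 9) x t.1)
    (move ((![![0, 1, 0, 1, 0, 0, 0, 0, 0, 0, 0, 0, 0, 0, 0, 0, 0, 0, 0, 0, 0, 0, 0],
      ![0, 0, 0, 0, 0, 0, 0, 0, 0, 0, 0, 0, 2, 2, 0, 0, 2, 0, 2, 2, 0, 0, 2],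
      ![0, 0, 0, 0, 0, 0, 0, 0, 0, 0, 0, 0, 2, 0, 2, 2, 0, 0, 2, 0, 2, 2, 0]] :
        Fin 3 → Fin 23 → Fin 3) x t.1) t.2)

/-- The colour of a vertex. -/
def colour : Fin 9 → Fin 3 := ![0, 0, 0, 0, 1, 1, 2, 2, 2]

/-- An edge of family `p` joins the two colours other than `p`; hence edges of different families
differ and every triangle meets all three families. -/
theorem colour_fstEnd (p : Fin 3) (l : Fin 9) (c : Fin r × Fin m) :
    colour (fstEnd p l c).1 = ![1, 0, 0] p := by
  revert p l
  simp only [fstEnd, vert]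
  decide

theorem colour_sndEnd (p : Fin 3) (l : Fin 9) (c : Fin r × Fin m) :
    colour (sndEnd p l c).1 = ![2, 2, 1] p := by
  revert p l
  simp only [sndEnd, vert]
  decide

theorem colour_corner (x : Fin 3) (t : Fin 23 × (Fin r × Fin m)) :
    colour (corner x t).1 = x := by
  obtain ⟨κ, c⟩ := t
  revert x κ
  simp only [corner, vert]
  decide

theorem fstEnd_eq_corner (p : Fin 3) (t : Fin 23 × (Fin r × Fin m)) :
    fstEnd p (loc p t.1) (move (sh p t.1) t.2) = corner (![1, 0, 0] p) t := by
  obtain ⟨κ, i, j⟩ := t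
  fin_cases p <;> fin_cases κ <;> simp [fstEnd, corner, vert, move, loc, sh]

theorem sndEnd_eq_corner (p : Fin 3) (t : Fin 23 × (Fin r × Fin m)) :
    sndEnd p (loc p t.1) (move (sh p t.1) t.2) = corner (![2, 2, 1] p) t := by
  obtain ⟨κ, i, j⟩ := t
  fin_cases p <;> fin_cases κ <;> simp [sndEnd, corner, vert, move, loc, sh]

/-- The bounds prevent collisions around the cyclic grid: with one column, edges 0 and 1 of family 2
coincide; with two rows, edges 7 and 8 of family 0 in consecutive cells do. -/
theorem ends_inj (hr : 3 ≤ r) (hm : 2 ≤ m) {p : Fin 3} {l l' : Fin 9} {c c' : Fin r × Fin m}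
    (h : fstEnd p l c = fstEnd p l' c') (h' : sndEnd p l c = sndEnd p l' c') :
    l = l' ∧ c = c' := by
  obtain ⟨i, j⟩ := c
  obtain ⟨i', j'⟩ := c'
  have h1 : ∀ x : Fin r, x + 1 ≠ x := fun x hx => by
    rcases val_add_one_cases x with h | h <;> rw [hx] at h <;> omega
  have h1' : ∀ x : Fin r, x ≠ x + 1 := fun x => (h1 x).symm
  have h2 : ∀ x : Fin r, x + 1 + 1 ≠ x := fun x hx => by
    rcases val_add_one_cases x with h | h <;> rcases val_add_one_cases (x + 1) with h' | h' <;>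
      rw [hx] at h' <;> omega
  have h3 : ∀ x : Fin m, x + 1 ≠ x := fun x hx => by
    rcases val_add_one_cases x with h | h <;> rw [hx] at h <;> omega
  fin_cases p <;> fin_cases l <;> fin_cases l' <;>
    simp [fstEnd, sndEnd, vert, move] at h h' ⊢ <;> grind

end

/-! ### The triangular configuration of the grid -/

section

variable {k n r m : ℕ}

theorem exists_eq_idx (i : Fin (9 * (r * m))) : ∃ l c, i = idx l c :=
  ⟨(finProdFinEquiv.symm i).1, finProdFinEquiv.symm (finProdFinEquiv.symm i).2, by
    simp only [idx, Prod.mk.eta, Equiv.apply_symm_apply]⟩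

theorem code_le_three (G : Matrix (Fin k) (Fin n) (ZMod 2)) (i j : ℕ) (κ : Fin 23) :
    code G r i j κ ≤ 3 := by
  have := ZMod.val_lt (extMat G i j)
  fin_cases κ <;> simp [code] <;> first | omega | split_ifs <;> simp

variable [NeZero r] [NeZero m]

/-- The ends of a numbered edge. -/
def edge (p : Fin 3) (i : Fin (9 * (r * m))) : Finset (Fin 9 × (Fin r × Fin m)) :=
  let l := (finProdFinEquiv.symm i).1
  let c := finProdFinEquiv.symm (finProdFinEquiv.symm i).2
  {fstEnd p l c, sndEnd p l c}

theorem edge_idx (p : Fin 3) (l : Fin 9) (c : Fin r × Fin m) :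
    edge p (idx l c) = {fstEnd p l c, sndEnd p l c} := by
  simp only [edge, idx, Equiv.symm_apply_apply]

/-- The triangle system of the grid, with the triangles that are present for the matrix `G`. -/
def system (G : Matrix (Fin k) (Fin n) (ZMod 2)) (hr : 3 ≤ r) (hm : 2 ≤ m) :
    TriangleSystem (Fin 9 × (Fin r × Fin m))
      {t : Fin 23 × (Fin r × Fin m) // code G r t.2.1 t.2.2 t.1 ≠ 0} (9 * (r * m)) where
  edge := edge
  triangle t := Finset.univ.image fun x => corner x t.1
  inc p t := inc p t.1
  card_edge p i := by
    obtain ⟨l, c, rfl⟩ := exists_eq_idx i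
    rw [edge_idx, Finset.card_pair]
    intro h
    have := congrArg (fun v => colour v.1) h
    simp only [colour_fstEnd, colour_sndEnd] at this
    fin_cases p <;> simp at this
  edge_inj p q i j h := by
    obtain ⟨l, c, rfl⟩ := exists_eq_idx i
    obtain ⟨l', c', rfl⟩ := exists_eq_idx j
    rw [edge_idx, edge_idx] at h
    have h1 : (fstEnd p l c = fstEnd q l' c' ∧ sndEnd p l c = sndEnd q l' c') ∨
        (fstEnd p l c = sndEnd q l' c' ∧ sndEnd p l c = fstEnd q l' c') := by
      have := congrArg (fun s : Finset _ => (s : Set (Fin 9 × (Fin r × Fin m)))) h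
      simpa only [Finset.coe_pair, Set.pair_eq_pair_iff] using this
    have h2 : p = q ∧ fstEnd p l c = fstEnd q l' c' ∧ sndEnd p l c = sndEnd q l' c' := by
      rcases h1 with h1 | h1
      all_goals
        have e1 := congrArg (fun v => colour v.1) h1.1
        have e2 := congrArg (fun v => colour v.1) h1.2
        simp only [colour_fstEnd, colour_sndEnd] at e1 e2
      · refine ⟨?_, h1⟩
        revert e1 e2
        clear * -
        revert p q
        decide
      · exfalso
        revert e1 e2
        clear * -
        revert p q
        decide
    obtain ⟨rfl, h3, h4⟩ := h2
    obtain ⟨rfl, rfl⟩ := ends_inj hr hm h3 h4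
    exact ⟨rfl, rfl⟩
  card_triangle t := by
    rw [Finset.card_image_of_injective, Finset.card_univ, Fintype.card_fin]
    intro x y h
    have := congrArg (fun v => colour v.1) h
    simpa only [colour_corner] using this
  edge_subset p t := by
    rw [inc, edge_idx, fstEnd_eq_corner, sndEnd_eq_corner]
    intro v hv
    rcases Finset.mem_insert.1 hv with rfl | hv
    · exact Finset.mem_image_of_mem _ (Finset.mem_univ _)
    · rw [Finset.mem_singleton.1 hv]
      exact Finset.mem_image_of_mem _ (Finset.mem_univ _)
  inc_inj t t' h := Subtype.ext (inc_inj _ _ h)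

/-- The 3-matrix of the grid. -/
noncomputable def array (G : Matrix (Fin k) (Fin n) (ZMod 2)) (r m : ℕ) [NeZero r] [NeZero m]
    (i j l : Fin (9 * (r * m))) : ℕ[X] :=
  ∑ t with inc 0 t = i ∧ inc 1 t = j ∧ inc 2 t = l, entry (r := r) (m := m) G t

theorem exists_triadjacency_eq_array (G : Matrix (Fin k) (Fin n) (ZMod 2)) (hr : 3 ≤ r)
    (hm : 2 ≤ m) :
    ∃ (Δ : TriangularConfiguration) (E : Δ.Tripartition) (w : Δ.triangles → ℕ)
      (ν : ∀ p : Fin 3, Fin (9 * (r * m)) ≃ E.part p), (∀ s, w s ≤ 2) ∧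
      Δ.triadjacency E w ν = array G r m := by
  have : Nonempty {t : Fin 23 × (Fin r × Fin m) // code G r t.2.1 t.2.2 t.1 ≠ 0} :=
    -- Kind 1 is present in every cell.
    ⟨⟨(1, 0), by simp [code]⟩⟩
  obtain ⟨Δ, E, w, ν, hw, hA⟩ := (system G hr hm).exists_triadjacency_eq
    fun t => code G r t.1.2.1 t.1.2.2 t.1.1 - 1
  refine ⟨Δ, E, w, ν, fun s => ?_, ?_⟩
  · obtain ⟨t, ht⟩ := hw s
    have := code_le_three (r := r) G t.1.2.1 t.1.2.2 t.1.1
    omega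
  · funext i j l
    rw [hA, array, Finset.sum_filter, Finset.sum_filter]
    have h : ∀ t : Fin 23 × (Fin r × Fin m), code G r t.2.1 t.2.2 t.1 = 0 →
        (if inc 0 t = i ∧ inc 1 t = j ∧ inc 2 t = l then entry G t else 0) = 0 := fun t ht => by
      rw [entry, if_pos ht, ite_self]
    -- Absent triangles have entry 0, so the sum may be restricted to the triangles of `system`.
    rw [← Finset.sum_subset (Finset.filter_subset
      (fun t : Fin 23 × (Fin r × Fin m) => code G r t.2.1 t.2.2 t.1 ≠ 0) Finset.univ)
      fun t _ ht => h t (by simpa using ht)]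
    rw [Finset.sum_subtype (p := fun t : Fin 23 × (Fin r × Fin m) => code G r t.2.1 t.2.2 t.1 ≠ 0)
      _ (by simp)]
    refine Finset.sum_congr rfl fun t _ => ?_
    rw [entry, if_neg t.2]
    rfl

end

end Grid

/-! ### Compiling arithmetic expressions -/

namespace RAM

/-- Arithmetic expressions in the registers. -/
inductive Expr where
  /-- a constant -/
  | lit (c : ℕ)
  /-- the content of a register -/
  | var (r : ℕ)
  /-- a sum -/
  | add (a b : Expr)
  /-- a truncated difference -/
  | sub (a b : Expr)
  /-- a product -/
  | mul (a b : Expr)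

namespace Expr

/-- The value of an expression. -/
def eval (v : ℕ → ℕ) : Expr → ℕ
  | lit c => c
  | var r => v r
  | add a b => a.eval v + b.eval v
  | sub a b => a.eval v - b.eval v
  | mul a b => a.eval v * b.eval v

/-- Only registers below `d` occur in the expression. -/
def Below (d : ℕ) : Expr → Prop
  | lit _ => True
  | var r => r < d
  | add a b => a.Below d ∧ b.Below d
  | sub a b => a.Below d ∧ b.Below d
  | mul a b => a.Below d ∧ b.Below d

theorem eval_congr {d : ℕ} {v v' : ℕ → ℕ} (h : ∀ r < d, v r = v' r) :
    ∀ {e : Expr}, e.Below d → e.eval v = e.eval v'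
  | lit _, _ => rfl
  | var _, hr => h _ hr
  | add _ _, hab => congrArg₂ (· + ·) (eval_congr h hab.1) (eval_congr h hab.2)
  | sub _ _, hab => congrArg₂ (· - ·) (eval_congr h hab.1) (eval_congr h hab.2)
  | mul _ _, hab => congrArg₂ (· * ·) (eval_congr h hab.1) (eval_congr h hab.2)

/-- A bound for the value of an expression in registers that contain at most `B`. -/
def bound (B : ℕ) : Expr → ℕ
  | lit c => c
  | var _ => B
  | add a b => a.bound B + b.bound B
  | sub a _ => a.bound B
  | mul a b => a.bound B * b.bound B

/-- A bound for the time needed to evaluate an expression. -/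
def cost (B : ℕ) : Expr → ℕ
  | lit _ => 1
  | var _ => 2
  | add a b => a.cost B + b.cost B + 1
  | sub a b => a.cost B + b.cost B + 1
  | mul a b => a.cost B + b.cost B + 3 * b.bound B + 5

theorem eval_le_bound {d B : ℕ} {v : ℕ → ℕ} (h : ∀ r < d, v r ≤ B) :
    ∀ {e : Expr}, e.Below d → e.eval v ≤ e.bound B
  | lit _, _ => le_rfl
  | var _, hr => h _ hr
  | add _ _, hab => Nat.add_le_add (eval_le_bound h hab.1) (eval_le_bound h hab.2)
  | sub _ _, hab => (Nat.sub_le _ _).trans (eval_le_bound h hab.1)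
  | mul _ _, hab => Nat.mul_le_mul (eval_le_bound h hab.1) (eval_le_bound h hab.2)

/-- A program that evaluates an expression into the register `d`. -/
def compile : Expr → ℕ → Program
  | lit c, d => .const d c
  | var r, d => .seq (.const d 0) (.add d d r)
  | add a b, d => .seq (a.compile d) (.seq (b.compile (d + 1)) (.add d d (d + 1)))
  | sub a b, d => .seq (a.compile d) (.seq (b.compile (d + 1)) (.sub d d (d + 1)))
  | mul a b, d => .seq (a.compile d) (.seq (b.compile (d + 1)) (.seq (.const (d + 2) 0)
      (.seq (.const (d + 3) 1) (.seq (.loop (d + 1)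
        (.seq (.add (d + 2) (d + 2) d) (.sub (d + 1) (d + 1) (d + 3))))
        (.seq (.const d 0) (.add d d (d + 2)))))))

/-- Repeated addition: a round is one test, one addition and one decrement, and a last test leaves
the loop. -/
theorem runs_mul_loop (d x : ℕ) : ∀ (y : ℕ) (s : State), s.reg d = x → s.reg (d + 1) = y →
    s.reg (d + 3) = 1 → ∃ s', Runs (.loop (d + 1)
      (.seq (.add (d + 2) (d + 2) d) (.sub (d + 1) (d + 1) (d + 3)))) s (3 * y + 1) s' ∧
      s'.mem = s.mem ∧ s'.reg (d + 2) = s.reg (d + 2) + x * y ∧ ∀ r < d, s'.reg r = s.reg r := by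
  intro y
  induction y with
  | zero => exact fun s _ h _ => ⟨s, Runs.loop_stop h, rfl, by simp, fun _ _ => rfl⟩
  | succ y ih =>
    intro s h0 h1 h3
    have hrun : Runs (.seq (.add (d + 2) (d + 2) d) (.sub (d + 1) (d + 1) (d + 3))) s 2
        ⟨Function.update (Function.update s.reg (d + 2) (s.reg (d + 2) + s.reg d)) (d + 1)
          (s.reg (d + 1) - s.reg (d + 3)), s.mem⟩ := by
      simpa using (Runs.add (d + 2) (d + 2) d s).seq (Runs.sub (d + 1) (d + 1) (d + 3) _)
    obtain ⟨s', hs', hmem, hreg, hlow⟩ := ih ⟨Function.update (Function.update s.reg (d + 2)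
      (s.reg (d + 2) + s.reg d)) (d + 1) (s.reg (d + 1) - s.reg (d + 3)), s.mem⟩
      (by simp [h0]) (by simp [h1, h3]) (by simp [h3])
    refine ⟨s', ?_, hmem, ?_, fun r hr => ?_⟩
    · have := Runs.loop_step (by omega) hrun hs'
      convert this using 1
      ring
    · rw [hreg]
      simp [h0]
      ring
    · rw [hlow r hr]
      simp [show r ≠ d + 1 by omega, show r ≠ d + 2 by omega]

/-- From the state `s`, the program evaluates `e` into the register `d` and preserves the memory and
the registers below `d`. -/
def Evaluates (P : Program) (s : State) (d x T : ℕ) : Prop :=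
  ∃ t s', t ≤ T ∧ Runs P s t s' ∧ s'.mem = s.mem ∧ s'.reg d = x ∧ ∀ r < d, s'.reg r = s.reg r

/-- The common beginning of all binary operations, with an arbitrary continuation `R`. As `b` only
reads registers below `D`, evaluating `a` first does not change its value. -/
theorem exists_runs_pair {D B : ℕ} {a b : Expr}
    (ha : ∀ {d}, D ≤ d → ∀ s : State, (∀ r < D, s.reg r ≤ B) →
      Evaluates (a.compile d) s d (a.eval s.reg) (a.cost B))
    (hb : ∀ {d}, D ≤ d → ∀ s : State, (∀ r < D, s.reg r ≤ B) →
      Evaluates (b.compile d) s d (b.eval s.reg) (b.cost B))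
    (hbD : b.Below D) {d : ℕ} (hd : D ≤ d) (s : State) (hs : ∀ r < D, s.reg r ≤ B) (R : Program) :
    ∃ t s', t ≤ a.cost B + b.cost B ∧ s'.mem = s.mem ∧ s'.reg d = a.eval s.reg ∧
      s'.reg (d + 1) = b.eval s.reg ∧ (∀ r < d, s'.reg r = s.reg r) ∧
      ∀ t' s'', Runs R s' t' s'' →
        Runs (.seq (a.compile d) (.seq (b.compile (d + 1)) R)) s (t + t') s'' := by
  obtain ⟨t₁, s₁, ht₁, hr₁, hm₁, hv₁, hl₁⟩ := ha hd s hs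
  obtain ⟨t₂, s₂, ht₂, hr₂, hm₂, hv₂, hl₂⟩ := hb (hd.trans d.le_succ) s₁ fun r hr => by
    rw [hl₁ r (by omega)]
    exact hs r hr
  refine ⟨t₁ + t₂, s₂, by omega, hm₂.trans hm₁, (hl₂ d (by omega)).trans hv₁, hv₂.trans ?_,
    fun r hr => (hl₂ r (by omega)).trans (hl₁ r hr), fun t' s'' h => ?_⟩
  · exact eval_congr (fun r hr => hl₁ r (by omega)) hbD
  · rw [add_assoc]
    exact hr₁.seq (hr₂.seq h)

theorem evaluates_compile {D B : ℕ} : ∀ (e : Expr), e.Below D → ∀ {d}, D ≤ d → ∀ s : State,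
    (∀ r < D, s.reg r ≤ B) → Evaluates (e.compile d) s d (e.eval s.reg) (e.cost B)
  | lit c, _, d, _, s, _ =>
    ⟨_, _, le_rfl, .const d c s, rfl, by simp [eval], fun r hr => by simp [hr.ne]⟩
  | var x, hx, d, hd, s, _ => by
    refine ⟨_, _, le_rfl, (Runs.const d 0 s).seq (.add d d x _), rfl, ?_, fun r hr => ?_⟩
    · have : x ≠ d := (lt_of_lt_of_le hx hd).ne
      simp [eval, this]
    · simp [hr.ne]
  | add a b, h, d, hd, s, hs => by
    obtain ⟨t, s', ht, hm, h0, h1, hl, hR⟩ := exists_runs_pair (evaluates_compile a h.1)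
      (evaluates_compile b h.2) h.2 hd s hs (.add d d (d + 1))
    refine ⟨_, _, ?_, hR _ _ (.add _ _ _ _), hm, ?_, fun r hr => ?_⟩
    · simpa [cost] using ht
    · simp [eval, h0, h1]
    · simp [hr.ne, hl r hr]
  | sub a b, h, d, hd, s, hs => by
    obtain ⟨t, s', ht, hm, h0, h1, hl, hR⟩ := exists_runs_pair (evaluates_compile a h.1)
      (evaluates_compile b h.2) h.2 hd s hs (.sub d d (d + 1))
    refine ⟨_, _, ?_, hR _ _ (.sub _ _ _ _), hm, ?_, fun r hr => ?_⟩
    · simpa [cost] using ht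
    · simp [eval, h0, h1]
    · simp [hr.ne, hl r hr]
  | mul a b, h, d, hd, s, hs => by
    obtain ⟨t, s', ht, hm, h0, h1, hl, hR⟩ := exists_runs_pair (evaluates_compile a h.1)
      (evaluates_compile b h.2) h.2 hd s hs _
    obtain ⟨s₂, hr₂, hm₂, hv₂, hl₂⟩ := runs_mul_loop d (a.eval s.reg) (b.eval s.reg)
      ⟨Function.update (Function.update s'.reg (d + 2) 0) (d + 3) 1, s'.mem⟩
      (by simp [h0]) (by simp [h1]) (by simp)
    refine ⟨_, _, ?_, hR _ _ (.seq (.const _ _ _) (.seq (.const _ _ _) (.seq hr₂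
      (.seq (.const _ _ _) (.add _ _ _ _))))), hm₂.trans hm, ?_, fun r hr => ?_⟩
    · have := eval_le_bound hs h.2
      simp only [cost]
      omega
    · simp only [Function.update_self, eval]
      rw [Function.update_of_ne (by omega), hv₂]
      simp
    · have h2 : r ≠ d + 2 := by omega
      have h3 : r ≠ d + 3 := by omega
      simp [hr.ne, hl₂ r hr, h2, h3, hl r hr]

end Expr

end RAM

/-! ### Polynomially bounded functions -/

/-- The function is bounded by a polynomial. -/
def PolyBounded (f : ℕ → ℕ) : Prop := ∃ q : ℕ[X], ∀ n, f n ≤ q.eval n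

namespace PolyBounded

theorem const (c : ℕ) : PolyBounded fun _ => c := ⟨Polynomial.C c, fun n => by simp⟩

theorem id : PolyBounded fun n => n := ⟨Polynomial.X, fun n => by simp⟩

theorem add {f g : ℕ → ℕ} : PolyBounded f → PolyBounded g → PolyBounded fun n => f n + g n
  | ⟨p, hp⟩, ⟨q, hq⟩ => ⟨p + q, fun n => by
    rw [Polynomial.eval_add]
    exact Nat.add_le_add (hp n) (hq n)⟩

theorem mul {f g : ℕ → ℕ} : PolyBounded f → PolyBounded g → PolyBounded fun n => f n * g n
  | ⟨p, hp⟩, ⟨q, hq⟩ => ⟨p * q, fun n => by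
    rw [Polynomial.eval_mul]
    exact Nat.mul_le_mul (hp n) (hq n)⟩

theorem list_sum {ι : Type*} {f : ι → ℕ → ℕ} : ∀ {L : List ι}, (∀ x ∈ L, PolyBounded (f x)) →
    PolyBounded fun n => (L.map fun x => f x n).sum
  | [], _ => by simpa using const 0
  | x :: L, h => by
    simpa using (h x (by simp)).add (list_sum fun y hy => h y (by simp [hy]))

end PolyBounded

namespace RAM

namespace Expr

theorem polyBounded_bound {B : ℕ → ℕ} (hB : PolyBounded B) :
    ∀ e : Expr, PolyBounded fun n => e.bound (B n)
  | lit c => .const c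
  | var _ => hB
  | add a b => (polyBounded_bound hB a).add (polyBounded_bound hB b)
  | sub a _ => polyBounded_bound hB a
  | mul a b => (polyBounded_bound hB a).mul (polyBounded_bound hB b)

theorem polyBounded_cost {B : ℕ → ℕ} (hB : PolyBounded B) :
    ∀ e : Expr, PolyBounded fun n => e.cost (B n)
  | lit _ => .const 1
  | var _ => .const 2
  | add a b => ((polyBounded_cost hB a).add (polyBounded_cost hB b)).add (.const 1)
  | sub a b => ((polyBounded_cost hB a).add (polyBounded_cost hB b)).add (.const 1)
  | mul a b => (((polyBounded_cost hB a).add (polyBounded_cost hB b)).add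
      ((PolyBounded.const 3).mul (polyBounded_bound hB b))).add (.const 5)

end Expr

/-! ### Statements -/

/-- `reg x := e`, using the registers from `d` on. -/
def setReg (d x : ℕ) (e : Expr) : Program :=
  .seq (e.compile d) (.seq (.const x 0) (.add x x d))

/-- `reg x := mem e`, using the registers from `d` on. -/
def loadReg (d x : ℕ) (e : Expr) : Program :=
  .seq (e.compile d) (.load x d)

/-- `mem e := mem e + e'` for a list of pairs `(e, e')`, using the registers from `d` on. -/
def addMem (d : ℕ) : List (Expr × Expr) → Program
  | [] => .const d 0
  | p :: L => .seq (p.1.compile d) (.seq (p.2.compile (d + 1)) (.seq (.load (d + 2) d)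
      (.seq (.add (d + 1) (d + 1) (d + 2)) (.seq (.store d (d + 1)) (addMem d L)))))

/-- Execute `P` for the values of the register `x` from `0` to the content of the register `y`,
using the registers from `d` on. -/
def forLoop (d x y : ℕ) (P : Program) : Program :=
  .seq (.const x 0) (.seq (.sub d y x)
    (.loop d (.seq P (.seq (.const d 1) (.seq (.add x x d) (.sub d y x))))))

variable {D B d : ℕ}

theorem runs_setReg {x : ℕ} {e : Expr} (he : e.Below D) (hd : D ≤ d) (hx : x < d) {s : State}
    (hs : ∀ r < D, s.reg r ≤ B) : ∃ t s', t ≤ e.cost B + 2 ∧ Runs (setReg d x e) s t s' ∧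
      s'.mem = s.mem ∧ s'.reg x = e.eval s.reg ∧ ∀ r < d, r ≠ x → s'.reg r = s.reg r := by
  obtain ⟨t, s', ht, hr, hm, hv, hl⟩ := e.evaluates_compile he hd s hs
  refine ⟨_, _, Nat.add_le_add_right ht 2, hr.seq ((Runs.const x 0 _).seq (.add x x d _)), hm, ?_,
    fun r hr hrx => ?_⟩
  · simp [hx.ne', hv]
  · simp [hrx, hl r hr]

theorem runs_loadReg {x : ℕ} {e : Expr} (he : e.Below D) (hd : D ≤ d) {s : State}
    (hs : ∀ r < D, s.reg r ≤ B) : ∃ t s', t ≤ e.cost B + 1 ∧ Runs (loadReg d x e) s t s' ∧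
      s'.mem = s.mem ∧ s'.reg x = s.mem (e.eval s.reg) ∧
      ∀ r < d, r ≠ x → s'.reg r = s.reg r := by
  obtain ⟨t, s', ht, hr, hm, hv, hl⟩ := e.evaluates_compile he hd s hs
  refine ⟨_, _, Nat.add_le_add_right ht 1, hr.seq (Runs.load x d _), hm, ?_, fun r hr hrx => ?_⟩
  · simp [hv, hm]
  · simp [hrx, hl r hr]

/-- Since values are added rather than overwritten, the effect is a sum over the list even if
addresses coincide. The 3-matrix is a sum over triangles in the same way. -/
theorem runs_addMem (hd : D ≤ d) : ∀ (L : List (Expr × Expr)),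
    (∀ p ∈ L, p.1.Below D ∧ p.2.Below D) → ∀ (s : State), (∀ r < D, s.reg r ≤ B) →
    ∃ t s', t ≤ (L.map fun p => p.1.cost B + p.2.cost B + 3).sum + 1 ∧ Runs (addMem d L) s t s' ∧
      (∀ r < d, s'.reg r = s.reg r) ∧ ∀ a, s'.mem a = s.mem a +
        (L.map fun p => if p.1.eval s.reg = a then p.2.eval s.reg else 0).sum
  -- A write to a scratch register plays the role of the empty program and costs the final 1.
  | [], _, s, _ => ⟨1, _, by simp, .const d 0 s, fun r hr => by simp [hr.ne], fun a => by simp⟩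
  | p :: L, hL, s, hs => by
    obtain ⟨hp₁, hp₂⟩ := hL p (by simp)
    obtain ⟨t, s', ht, hm, h0, h1, hl, hR⟩ := Expr.exists_runs_pair (Expr.evaluates_compile p.1 hp₁)
      (Expr.evaluates_compile p.2 hp₂) hp₂ hd s hs _
    obtain ⟨t₂, s₂, ht₂, hr₂, hl₂, hm₂⟩ := runs_addMem hd L (fun p hp => hL p (by simp [hp]))
      ⟨Function.update (Function.update s'.reg (d + 2) (s'.mem (s'.reg d))) (d + 1)
        (s'.reg (d + 1) + s'.mem (s'.reg d)),
        Function.update s'.mem (s'.reg d) (s'.reg (d + 1) + s'.mem (s'.reg d))⟩ fun r hr => by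
          have h2 : r ≠ d + 1 := by omega
          have h3 : r ≠ d + 2 := by omega
          simpa [h2, h3, hl r (by omega)] using hs r hr
    have hlow : ∀ r < d, s₂.reg r = s.reg r := fun r hr => by
      have h2 : r ≠ d + 1 := by omega
      have h3 : r ≠ d + 2 := by omega
      simpa [h2, h3, hl r hr] using hl₂ r hr
    refine ⟨_, s₂, ?_, hR _ _ ((Runs.load _ _ _).seq ((Runs.add _ _ _ _).seq
      ((Runs.store _ _ _).seq (t' := t₂) ?_))), hlow, fun a => ?_⟩
    · simp only [List.map_cons, List.sum_cons]
      omega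
    · simpa using hr₂
    · have heval : ∀ e : Expr, e.Below D → e.eval (Function.update (Function.update s'.reg (d + 2)
          (s'.mem (s'.reg d))) (d + 1) (s'.reg (d + 1) + s'.mem (s'.reg d))) = e.eval s.reg :=
        fun e he => Expr.eval_congr (fun r hr => by
          have h2 : r ≠ d + 1 := by omega
          have h3 : r ≠ d + 2 := by omega
          simp [h2, h3, hl r (by omega)]) he
      rw [hm₂, List.map_cons, List.sum_cons, ← add_assoc]
      congr 1
      · simp only [h0, h1, hm, Function.update_apply]
        by_cases h : p.1.eval s.reg = a
        · simp [h, add_comm]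
        · simp [h, Ne.symm h]
      · congr 1
        refine List.map_congr_left fun p hp => ?_
        rw [heval _ (hL p (by simp [hp])).1, heval _ (hL p (by simp [hp])).2]

/-- The rule for loops. The invariant may not depend on the counter. -/
theorem runs_forLoop {x y L T : ℕ} {P : Program} (hx : x < d) (hy : y < d) (hxy : x ≠ y)
    (I : ℕ → State → Prop)
    (hI : ∀ i s s', s'.mem = s.mem → (∀ r < d, r ≠ x → s'.reg r = s.reg r) → I i s → I i s')
    (hy' : ∀ i s, I i s → s.reg y = L)
    (hP : ∀ i < L, ∀ s, I i s → s.reg x = i → ∃ t s', t ≤ T ∧ Runs P s t s' ∧ s'.reg x = i ∧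
      I (i + 1) s')
    (s : State) (hs : I 0 s) :
    ∃ t s', t ≤ L * (T + 4) + 3 ∧ Runs (forLoop d x y P) s t s' ∧ I L s' := by
  -- Induction on the number `l` of remaining rounds, which register `d` holds at each test.
  have key : ∀ l i s, i + l = L → I i s → s.reg x = i → s.reg d = l → ∃ t s', t ≤ l * (T + 4) + 1 ∧
      Runs (.loop d (.seq P (.seq (.const d 1) (.seq (.add x x d) (.sub d y x))))) s t s' ∧
      I L s' := by
    intro l
    induction l with
    | zero =>
      rintro i s rfl hi - hd
      exact ⟨1, s, by omega, Runs.loop_stop hd, hi⟩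
    | succ l ih =>
      intro i s hil hi hix hd
      obtain ⟨t, s', ht, hr, hx', hi'⟩ := hP i (by omega) s hi hix
      have hrun := hr.seq ((Runs.const d 1 s').seq ((Runs.add x x d _).seq (.sub d y x _)))
      obtain ⟨t₂, s₂, ht₂, hr₂, hi₂⟩ := ih (i + 1) ⟨_, _⟩ (by omega)
        (hI (i + 1) s' ⟨Function.update (Function.update (Function.update s'.reg d 1) x
          (s'.reg x + 1)) d (L - (i + 1)), s'.mem⟩ rfl (fun r hr hrx => by
            simp [hr.ne, hrx]) hi') (by simp [hx.ne, hx']) (by simp; omega)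
      refine ⟨_, s₂, ?_, .loop_step (by omega) hrun (t' := t₂) ?_, hi₂⟩
      · rw [add_mul]
        omega
      · convert hr₂ using 2
        · have := hy' _ _ hi'
          simp [hx.ne, hy.ne, hxy.symm, this, hx']
  obtain ⟨t, s', ht, hr, hi⟩ := key L 0 ⟨Function.update (Function.update s.reg x 0) d L, s.mem⟩
    (by simp) (hI 0 s _ rfl (fun r hr hrx => by simp [hr.ne, hrx]) hs) (by simp [hx.ne]) (by simp)
  refine ⟨_, s', ?_, (Runs.const x 0 s).seq ((Runs.sub d y x _).seq (t' := t) ?_), hi⟩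
  · omega
  · convert hr using 2
    have := hy' _ _ hs
    simp [hxy.symm, this]

end RAM

/-! ### The program -/

namespace Grid

open RAM Expr

/-- The expression for `1` if the value is positive and `0` otherwise. -/
def posExpr (e : Expr) : Expr := sub (lit 1) (sub (lit 1) e)

/-- The expression for `0` if the register `x` contains the last value below the content of the
register `y`, and `1` otherwise. -/
def notLastExpr (x y : ℕ) : Expr := posExpr (sub (sub (var y) (lit 1)) (var x))

/-- The expression for the cyclic successor of the register `x`. -/
def nextExpr (x y : ℕ) : Expr := mul (add (var x) (lit 1)) (notLastExpr x y)

/-- The expression for the number of an edge of a triangle. -/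
def incExpr (p : Fin 3) (κ : Fin 23) : Expr :=
  add (add (if sh p κ = 1 then nextExpr 7 4 else var 7)
    (mul (var 4) (if sh p κ = 2 then nextExpr 6 5 else var 6)))
    (mul (mul (var 5) (var 4)) (lit (loc p κ)))

/-- The expression for the address of the entry of a triangle. -/
def adrExpr (κ : Fin 23) : Expr :=
  add (var 1) (add (mul (add (mul (incExpr 0 κ) (var 0)) (incExpr 1 κ)) (var 0)) (incExpr 2 κ))

/-- The expression for the entry of a triangle. -/
def codeExpr : Fin 23 → Expr :=
  ![sub (lit 1) (var 9), lit 1, lit 1, posExpr (sub (var 3) (var 6)),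
    mul (lit 3) (sub (lit 1) (notLastExpr 6 5)),
    var 9, lit 1, lit 1, lit 1, lit 1, lit 1,
    var 9, lit 1, lit 1, lit 1, lit 1, lit 1,
    notLastExpr 6 5, lit 1, lit 1, lit 1, lit 1, lit 1]

/-- The expression for `1` if the cell belongs to the given matrix. -/
def insideExpr : Expr :=
  mul (posExpr (sub (var 3) (var 6))) (posExpr (sub (var 2) (var 7)))

/-- The expression for the address of the entry of the given matrix. -/
def sourceExpr : Expr :=
  mul (add (add (lit 2) (mul (var 6) (var 2))) (var 7)) (var 8)

/-- The entries of a cell. -/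
def entryExprs : List (Expr × Expr) :=
  (List.finRange 23).map fun κ => (adrExpr κ, codeExpr κ)

/-- The program for a cell. -/
def cellProgram : Program :=
  .seq (setReg 10 8 insideExpr) (.seq (loadReg 10 9 sourceExpr)
    (.seq (setReg 10 9 (mul (var 9) (var 8))) (addMem 10 entryExprs)))

/-- The program that initializes the registers. -/
def initProgram : Program :=
  .seq (loadReg 10 3 (lit 0)) (.seq (loadReg 10 2 (lit 1))
    (.seq (setReg 10 4 (add (var 2) (lit 2))) (.seq (setReg 10 5 (mul (lit 2) (var 4)))
      (.seq (setReg 10 0 (mul (lit 9) (mul (var 5) (var 4)))) (setReg 10 1 (var 0))))))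

/-- The program for the grid. -/
def gridProgram : Program :=
  .seq initProgram (forLoop 10 6 5 (forLoop 10 7 4 cellProgram))

/-- A bound for the running time of `cellProgram`. -/
def cellCost (B : ℕ) : ℕ :=
  (insideExpr.cost B + 2) + ((sourceExpr.cost B + 1) + (((mul (var 9) (var 8)).cost B + 2) +
    ((entryExprs.map fun p => p.1.cost B + p.2.cost B + 3).sum + 1)))

/-- A bound for the running time of `initProgram`. -/
def initCost (B : ℕ) : ℕ :=
  ((lit 0).cost B + 1) + (((lit 1).cost B + 1) + (((add (var 2) (lit 2)).cost B + 2) +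
    (((mul (lit 2) (var 4)).cost B + 2) + (((mul (lit 9) (mul (var 5) (var 4))).cost B + 2) +
      ((var 0).cost B + 2)))))

/-- A bound for the running time of `gridProgram`. -/
def gridCost (n : ℕ) : ℕ :=
  initCost (9 * (2 * (n + 2) * (n + 2))) +
    (2 * (n + 2) * (((n + 2) * (cellCost (9 * (2 * (n + 2) * (n + 2))) + 4) + 3) + 4) + 3)

theorem polyBounded_size : PolyBounded fun n => 9 * (2 * (n + 2) * (n + 2)) :=
  (PolyBounded.const 9).mul (((PolyBounded.const 2).mul (PolyBounded.id.add (.const 2))).mul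
    (PolyBounded.id.add (.const 2)))

theorem polyBounded_gridCost : PolyBounded gridCost := by
  have h := fun e => polyBounded_cost polyBounded_size e
  have hm : PolyBounded fun n => n + 2 := PolyBounded.id.add (.const 2)
  have hc : PolyBounded fun n => cellCost (9 * (2 * (n + 2) * (n + 2))) :=
    ((h _).add (.const 2)).add (((h _).add (.const 1)).add (((h _).add (.const 2)).add
      ((PolyBounded.list_sum fun p _ => ((h p.1).add (h p.2)).add (.const 3)).add (.const 1))))
  have hi : PolyBounded fun n => initCost (9 * (2 * (n + 2) * (n + 2))) :=
    ((h _).add (.const 1)).add (((h _).add (.const 1)).add (((h _).add (.const 2)).add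
      (((h _).add (.const 2)).add (((h _).add (.const 2)).add ((h _).add (.const 2))))))
  exact hi.add (((((PolyBounded.const 2).mul hm).mul (((hm.mul (hc.add (.const 4))).add
    (.const 3)).add (.const 4)))).add (.const 3))

/-- The cyclic successor. -/
def next (r i : ℕ) : ℕ := if i + 1 = r then 0 else i + 1

/-- The number of an edge of a triangle. -/
def incNat (r m : ℕ) (p : Fin 3) (κ : Fin 23) (i j : ℕ) : ℕ :=
  ((if sh p κ = 1 then next m j else j) + m * (if sh p κ = 2 then next r i else i)) +
    r * m * loc p κ

/-- The position of the entry of a triangle. -/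
def posNat (r m : ℕ) (κ : Fin 23) (i j : ℕ) : ℕ :=
  (incNat r m 0 κ i j * (9 * (r * m)) + incNat r m 1 κ i j) * (9 * (r * m)) + incNat r m 2 κ i j

/-- Unfolding `finProdFinEquiv`, edge `l` of the cell `(i, j)` has the number `j + m * i + r * m *
l`. -/
theorem val_inc {r m : ℕ} [NeZero r] [NeZero m] (p : Fin 3) (κ : Fin 23) (i : Fin r) (j : Fin m) :
    (inc p (κ, (i, j))).val = incNat r m p κ i j := by
  have hi : (i + 1).val = next r i := by
    unfold next
    rcases val_add_one_cases i with h | h <;> simp [h]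
  have hj : (j + 1).val = next m j := by
    unfold next
    rcases val_add_one_cases j with h | h <;> simp [h]
  have h3 : ∀ x : Fin 3, x = 0 ∨ x = 1 ∨ x = 2 := by decide
  rw [inc, idx, incNat]
  rcases h3 (sh p κ) with h | h | h <;> simp [h, move, hi, hj]

theorem eval_notLastExpr {v : ℕ → ℕ} {x y : ℕ} (h : v x < v y) :
    (notLastExpr x y).eval v = if v x + 1 = v y then 0 else 1 := by
  simp only [notLastExpr, posExpr, eval]
  split_ifs <;> omega

theorem eval_nextExpr {v : ℕ → ℕ} {x y : ℕ} (h : v x < v y) :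
    (nextExpr x y).eval v = next (v y) (v x) := by
  rw [nextExpr, eval, eval_notLastExpr h, next]
  split_ifs <;> simp [eval]

theorem eval_incExpr {v : ℕ → ℕ} (h6 : v 6 < v 5) (h7 : v 7 < v 4) (p : Fin 3) (κ : Fin 23) :
    (incExpr p κ).eval v = incNat (v 5) (v 4) p κ (v 6) (v 7) := by
  simp only [incExpr, incNat, eval]
  congr 2
  · split_ifs
    · exact eval_nextExpr h7
    · rfl
  · split_ifs
    · rw [eval_nextExpr h6]
    · rfl

theorem eval_adrExpr {v : ℕ → ℕ} (h6 : v 6 < v 5) (h7 : v 7 < v 4)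
    (h0 : v 0 = 9 * (v 5 * v 4)) (κ : Fin 23) :
    (adrExpr κ).eval v = v 1 + posNat (v 5) (v 4) κ (v 6) (v 7) := by
  simp only [adrExpr, eval, eval_incExpr h6 h7, posNat, h0]

theorem eval_codeExpr {k n : ℕ} (G : Matrix (Fin k) (Fin n) (ZMod 2)) {v : ℕ → ℕ}
    (h6 : v 6 < v 5) (h3 : v 3 = k) (h9 : v 9 = (extMat G (v 6) (v 7)).val) (κ : Fin 23) :
    (codeExpr κ).eval v = code G (v 5) (v 6) (v 7) κ := by
  have h := eval_notLastExpr h6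
  have hk : (posExpr (sub (var 3) (var 6))).eval v = if v 6 < k then 1 else 0 := by
    simp only [posExpr, eval, h3]
    split_ifs <;> omega
  have hz : 3 * (1 - (notLastExpr 6 5).eval v) = if v 6 + 1 = v 5 then 3 else 0 := by
    rw [h]
    split_ifs <;> rfl
  fin_cases κ <;> first | rfl | exact h | exact hk | exact hz | exact h9 |
    exact congrArg (1 - ·) h9

theorem below_incExpr (p : Fin 3) (κ : Fin 23) : (incExpr p κ).Below 10 := by
  unfold incExpr
  split_ifs <;> simp [nextExpr, notLastExpr, posExpr, Below]

theorem below_entryExprs : ∀ p ∈ entryExprs, p.1.Below 10 ∧ p.2.Below 10 := by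
  intro p hp
  obtain ⟨κ, -, rfl⟩ := List.mem_map.1 hp
  constructor
  · simp [adrExpr, Below, below_incExpr]
  · fin_cases κ <;> simp [codeExpr, notLastExpr, posExpr, Below]

/-! ### Correctness and running time of the program -/

open RAM Expr

/-- The contents of the registers that are constant in the loops. -/
structure Core (k n r m : ℕ) (v : ℕ → ℕ) : Prop where
  size : v 0 = 9 * (r * m)
  base : v 1 = 9 * (r * m)
  length : v 2 = n
  dim : v 3 = k
  cols : v 4 = m
  rows : v 5 = r

theorem Core.congr {k n r m : ℕ} {v v' : ℕ → ℕ} (h : Core k n r m v) (h' : ∀ x < 6, v' x = v x) :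
    Core k n r m v' :=
  ⟨(h' 0 (by omega)).trans h.size, (h' 1 (by omega)).trans h.base,
    (h' 2 (by omega)).trans h.length, (h' 3 (by omega)).trans h.dim,
    (h' 4 (by omega)).trans h.cols, (h' 5 (by omega)).trans h.rows⟩

/-- The contribution of a cell to the memory. -/
def cellSum {k n : ℕ} (G : Matrix (Fin k) (Fin n) (ZMod 2)) (r m i j a : ℕ) : ℕ :=
  ∑ κ, if 9 * (r * m) + posNat r m κ i j = a then code G r i j κ else 0

variable {k n r m : ℕ} (G : Matrix (Fin k) (Fin n) (ZMod 2))

/-- The output starts at the address `9 * (r * m)`, so the input below it stays readable throughout.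
-/
theorem cellSum_eq_zero {i j a : ℕ} (ha : a < 9 * (r * m)) : cellSum G r m i j a = 0 :=
  Finset.sum_eq_zero fun κ _ => if_neg (by omega)

theorem exists_runs_cell {μ : ℕ → ℕ} (hμ0 : μ 0 = k)
    (hμ : ∀ (x : Fin k) (y : Fin n), μ (2 + x * n + y) = (G x y).val)
    (hkr : k < r) (hnm : n ≤ m) (hm : 2 ≤ m) (hN : 2 + k * n ≤ 9 * (r * m))
    {i j : ℕ} (hi : i < r) (hj : j < m)
    {s : State} (hcore : Core k n r m s.reg) (h6 : s.reg 6 = i) (h7 : s.reg 7 = j)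
    (hmem : ∀ a < 9 * (r * m), s.mem a = μ a) :
    ∃ t s', t ≤ cellCost (9 * (r * m)) ∧ Runs cellProgram s t s' ∧
      (∀ x < 8, s'.reg x = s.reg x) ∧ ∀ a, s'.mem a = s.mem a + cellSum G r m i j a := by
  have hrm : r ≤ r * m := Nat.le_mul_of_pos_right r (by omega)
  have hmr : m ≤ r * m := Nat.le_mul_of_pos_left m (by omega)
  have hB : ∀ x < 8, s.reg x ≤ 9 * (r * m) := by
    intro x hx
    have := hcore.size
    have := hcore.base
    have := hcore.length
    have := hcore.dim
    have := hcore.cols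
    have := hcore.rows
    interval_cases x <;> omega
  obtain ⟨t₁, s₁, ht₁, hr₁, hm₁, hv₁, hl₁⟩ := runs_setReg (D := 8) (d := 10) (x := 8)
    (e := insideExpr) (by simp [insideExpr, posExpr, Below]) (by omega) (by omega) hB
  have hv₁' : s₁.reg 8 = if i < k ∧ j < n then 1 else 0 := by
    rw [hv₁]
    simp only [insideExpr, posExpr, eval, h6, h7, hcore.dim, hcore.length]
    by_cases h1 : i < k
    · have e1 : 1 - (1 - (k - i)) = 1 := by omega
      rw [e1]
      split_ifs <;> omega
    · have e1 : 1 - (1 - (k - i)) = 0 := by omega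
      rw [e1, if_neg fun h => h1 h.1, zero_mul]
  have hB₁ : ∀ x < 9, s₁.reg x ≤ 9 * (r * m) := by
    intro x hx
    by_cases h : x = 8
    · subst h
      rw [hv₁']
      split_ifs <;> omega
    · rw [hl₁ x (by omega) h]
      exact hB x (by omega)
  obtain ⟨t₂, s₂, ht₂, hr₂, hm₂, hv₂, hl₂⟩ := runs_loadReg (D := 9) (d := 10) (x := 9)
    (e := sourceExpr) (by simp [sourceExpr, Below]) (by omega) hB₁
  have hv₂' : s₂.reg 9 * s₁.reg 8 = (extMat G i j).val ∧ s₂.reg 9 ≤ 9 * (r * m) := by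
    rw [hv₂, hm₁]
    simp only [sourceExpr, eval]
    rw [hl₁ 2 (by omega) (by omega), hl₁ 6 (by omega) (by omega), hl₁ 7 (by omega) (by omega),
      hv₁', h6, h7, hcore.length]
    split_ifs with h
    · have h1 : (i + 1) * n ≤ k * n := Nat.mul_le_mul_right n h.1
      rw [add_mul, one_mul] at h1
      rw [mul_one, hmem _ (by omega), mul_one, hμ ⟨i, h.1⟩ ⟨j, h.2⟩, extMat, dif_pos h]
      have := ZMod.val_lt (G ⟨i, h.1⟩ ⟨j, h.2⟩)
      exact ⟨rfl, by omega⟩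
    -- Outside the matrix the flag in register 8 turns the address into 0. The number `k` read there
    -- respects the register bound and is later multiplied by the flag 0.
    · rw [mul_zero, mul_zero, hmem 0 (by omega), hμ0, extMat, dif_neg h]
      exact ⟨rfl, by omega⟩
  have hB₂ : ∀ x < 10, s₂.reg x ≤ 9 * (r * m) := by
    intro x hx
    by_cases h : x = 9
    · subst h
      exact hv₂'.2
    · rw [hl₂ x (by omega) h]
      exact hB₁ x (by omega)
  obtain ⟨t₃, s₃, ht₃, hr₃, hm₃, hv₃, hl₃⟩ := runs_setReg (D := 10) (d := 10) (x := 9)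
    (e := mul (var 9) (var 8)) (by simp [Below]) le_rfl (by omega) hB₂
  have hv₃' : s₃.reg 9 = (extMat G i j).val := by
    rw [hv₃]
    simp only [eval]
    rw [hl₂ 8 (by omega) (by omega)]
    exact hv₂'.1
  have hB₃ : ∀ x < 10, s₃.reg x ≤ 9 * (r * m) := by
    intro x hx
    by_cases h : x = 9
    · subst h
      have := ZMod.val_lt (extMat G i j)
      omega
    · rw [hl₃ x (by omega) h]
      exact hB₂ x (by omega)
  obtain ⟨t₄, s₄, ht₄, hr₄, hl₄, hm₄⟩ := runs_addMem (D := 10) (d := 10) le_rfl entryExprs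
    below_entryExprs s₃ hB₃
  have hlow : ∀ x < 8, s₃.reg x = s.reg x := fun x hx => by
    rw [hl₃ x (by omega) (by omega), hl₂ x (by omega) (by omega), hl₁ x (by omega) (by omega)]
  refine ⟨_, s₄, ?_, hr₁.seq (hr₂.seq (hr₃.seq hr₄)), fun x hx => ?_, fun a => ?_⟩
  · unfold cellCost
    omega
  · rw [hl₄ x (by omega), hlow x hx]
  · have hcore₃ : Core k n r m s₃.reg := hcore.congr fun x hx => hlow x (by omega)
    have e4 := hcore₃.cols
    have e5 := hcore₃.rows
    have e6 := (hlow 6 (by omega)).trans h6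
    have e7 := (hlow 7 (by omega)).trans h7
    rw [hm₄, hm₃, hm₂, hm₁, cellSum, Fin.sum_univ_def, entryExprs, List.map_map]
    congr 3
    funext κ
    simp only [Function.comp]
    rw [eval_adrExpr (by omega) (by omega) (by rw [hcore₃.size, e4, e5]),
      eval_codeExpr G (by omega) hcore₃.dim (by rw [e6, e7, hv₃']), hcore₃.base, e4, e5, e6, e7]

theorem exists_runs_loops {μ : ℕ → ℕ} (hμ0 : μ 0 = k)
    (hμ : ∀ (x : Fin k) (y : Fin n), μ (2 + x * n + y) = (G x y).val)
    (hkr : k < r) (hnm : n ≤ m) (hm : 2 ≤ m) (hN : 2 + k * n ≤ 9 * (r * m))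
    {s : State} (hcore : Core k n r m s.reg) (hmem : s.mem = μ) :
    ∃ t s', t ≤ r * ((m * (cellCost (9 * (r * m)) + 4) + 3) + 4) + 3 ∧
      Runs (forLoop 10 6 5 (forLoop 10 7 4 cellProgram)) s t s' ∧ Core k n r m s'.reg ∧
      ∀ a, s'.mem a = μ a + ∑ i ∈ Finset.range r, ∑ j ∈ Finset.range m, cellSum G r m i j a := by
  refine runs_forLoop (d := 10) (x := 6) (y := 5) (by omega) (by omega) (by omega)
    (fun i s => Core k n r m s.reg ∧
      ∀ a, s.mem a = μ a + ∑ i ∈ Finset.range i, ∑ j ∈ Finset.range m, cellSum G r m i j a)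
    (fun i s s' h h' hI => ⟨hI.1.congr fun x hx => h' x (by omega) (by omega), h ▸ hI.2⟩)
    (fun i s hI => hI.1.rows) ?_ s ⟨hcore, fun a => by simp [hmem]⟩
  intro i hi s ⟨hcore, hmem⟩ h6
  obtain ⟨t, s', ht, hr, hI⟩ := runs_forLoop (d := 10) (x := 7) (y := 4) (L := m)
    (T := cellCost (9 * (r * m))) (P := cellProgram) (by omega) (by omega) (by omega)
    (fun j s' => (Core k n r m s'.reg ∧ s'.reg 6 = i) ∧
      ∀ a, s'.mem a = s.mem a + ∑ j ∈ Finset.range j, cellSum G r m i j a)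
    (fun j s s' h h' hI => ⟨⟨hI.1.1.congr fun x hx => h' x (by omega) (by omega),
      (h' 6 (by omega) (by omega)).trans hI.1.2⟩, h ▸ hI.2⟩)
    (fun j s hI => hI.1.1.cols) (fun j hj s' ⟨⟨hcore', h6'⟩, hmem'⟩ h7 => by
      obtain ⟨t, s'', ht, hr, hl, hm''⟩ := exists_runs_cell G hμ0 hμ hkr hnm hm hN hi hj hcore' h6'
        h7 (fun a ha => by
          rw [hmem', hmem, Finset.sum_eq_zero fun j _ => cellSum_eq_zero G ha,
            Finset.sum_eq_zero fun i _ => Finset.sum_eq_zero fun j _ => cellSum_eq_zero G ha]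
          rfl)
      refine ⟨t, s'', ht, hr, (hl 7 (by omega)).trans h7,
        ⟨hcore'.congr fun x hx => hl x (by omega), (hl 6 (by omega)).trans h6'⟩, fun a => ?_⟩
      rw [hm'', hmem', Finset.sum_range_succ, add_assoc])
    s ⟨⟨hcore, h6⟩, fun a => by simp⟩
  refine ⟨t, s', ht, hr, hI.1.2, hI.1.1, fun a => ?_⟩
  rw [hI.2, hmem, Finset.sum_range_succ, add_assoc]

/-- Tracking the low registers by an explicit function `v` lets `simp` evaluate the chain of
assignments in `initProgram`. -/
theorem runs_setReg_update {x B : ℕ} {e : Expr} (he : e.Below 10) (hx : x < 10) {s : State}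
    {v : ℕ → ℕ} (hs : ∀ y < 10, s.reg y = v y) (hv : ∀ y, v y ≤ B) :
    ∃ t s', t ≤ e.cost B + 2 ∧ Runs (setReg 10 x e) s t s' ∧ s'.mem = s.mem ∧
      ∀ y < 10, s'.reg y = Function.update v x (e.eval v) y := by
  obtain ⟨t, s', ht, hr, hm, hx', hl⟩ := runs_setReg (D := 10) (d := 10) (B := B) he le_rfl hx
    (s := s) fun y hy => (hs y hy).trans_le (hv y)
  refine ⟨t, s', ht, hr, hm, fun y hy => ?_⟩
  by_cases h : y = x
  · subst h
    rw [hx', Function.update_self, Expr.eval_congr hs he]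
  · rw [hl y hy h, hs y hy, Function.update_of_ne h]

theorem runs_loadReg_update {x B : ℕ} {e : Expr} (he : e.Below 10) {s : State}
    {v : ℕ → ℕ} (hs : ∀ y < 10, s.reg y = v y) (hv : ∀ y, v y ≤ B) :
    ∃ t s', t ≤ e.cost B + 1 ∧ Runs (loadReg 10 x e) s t s' ∧ s'.mem = s.mem ∧
      ∀ y < 10, s'.reg y = Function.update v x (s.mem (e.eval v)) y := by
  obtain ⟨t, s', ht, hr, hm, hx', hl⟩ := runs_loadReg (D := 10) (d := 10) (B := B) (x := x) he
    le_rfl (s := s) fun y hy => (hs y hy).trans_le (hv y)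
  refine ⟨t, s', ht, hr, hm, fun y hy => ?_⟩
  by_cases h : y = x
  · subst h
    rw [hx', Function.update_self, Expr.eval_congr hs he]
  · rw [hl y hy h, hs y hy, Function.update_of_ne h]

theorem update_le {v : ℕ → ℕ} {B x c : ℕ} (hv : ∀ y, v y ≤ B) (hc : c ≤ B) (y : ℕ) :
    Function.update v x c y ≤ B := by
  rw [Function.update_apply]
  split_ifs
  exacts [hc, hv y]

theorem exists_runs_init (hkn : k ≤ n) {s : State} (hs : ∀ x, s.reg x = 0) (h0 : s.mem 0 = k)
    (h1 : s.mem 1 = n) :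
    ∃ t s', t ≤ initCost (9 * (2 * (n + 2) * (n + 2))) ∧ Runs initProgram s t s' ∧
      s'.mem = s.mem ∧ Core k n (2 * (n + 2)) (n + 2) s'.reg := by
  have hB : 2 * (n + 2) ≤ 2 * (n + 2) * (n + 2) := Nat.le_mul_of_pos_right _ (by omega)
  have hv₀ : ∀ y, (fun _ => 0 : ℕ → ℕ) y ≤ 9 * (2 * (n + 2) * (n + 2)) := fun _ => Nat.zero_le _
  obtain ⟨t₁, s₁, ht₁, hr₁, hm₁, hs₁⟩ := runs_loadReg_update (x := 3) (e := lit 0) trivial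
    (fun y _ => hs y) hv₀
  have hv₁ := update_le hv₀ (x := 3) (c := s.mem ((lit 0).eval fun _ => 0)) (by
    simp only [eval, h0]; omega)
  obtain ⟨t₂, s₂, ht₂, hr₂, hm₂, hs₂⟩ := runs_loadReg_update (x := 2) (e := lit 1) trivial hs₁ hv₁
  rw [hm₁] at hs₂
  simp only [eval, h0, h1] at hs₂ hv₁
  have hv₂ := update_le hv₁ (x := 2) (c := n) (by omega)
  obtain ⟨t₃, s₃, ht₃, hr₃, hm₃, hs₃⟩ := runs_setReg_update (x := 4) (e := add (var 2) (lit 2))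
    (by simp [Below]) (by omega) hs₂ hv₂
  simp only [eval, Function.update_self] at hs₃
  have hv₃ := update_le hv₂ (x := 4) (c := n + 2) (by omega)
  obtain ⟨t₄, s₄, ht₄, hr₄, hm₄, hs₄⟩ := runs_setReg_update (x := 5) (e := mul (lit 2) (var 4))
    (by simp [Below]) (by omega) hs₃ hv₃
  simp only [eval, Function.update_self] at hs₄
  have hv₄ := update_le hv₃ (x := 5) (c := 2 * (n + 2)) (by omega)
  obtain ⟨t₅, s₅, ht₅, hr₅, hm₅, hs₅⟩ := runs_setReg_update (x := 0)
    (e := mul (lit 9) (mul (var 5) (var 4))) (by simp [Below]) (by omega) hs₄ hv₄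
  simp only [eval, Function.update_self, Function.update_of_ne (show 4 ≠ 5 by omega)] at hs₅
  have hv₅ := update_le hv₄ (x := 0) (c := 9 * (2 * (n + 2) * (n + 2))) le_rfl
  obtain ⟨t₆, s₆, ht₆, hr₆, hm₆, hs₆⟩ := runs_setReg_update (x := 1) (e := var 0)
    (by simp [Below]) (by omega) hs₅ hv₅
  refine ⟨_, s₆, ?_, hr₁.seq (hr₂.seq (hr₃.seq (hr₄.seq (hr₅.seq hr₆)))),
    by rw [hm₆, hm₅, hm₄, hm₃, hm₂, hm₁], ?_⟩
  · unfold initCost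
    omega
  · constructor <;> rw [hs₆ _ (by omega)] <;> simp [eval]

open RAM

/-! ### The memory contents are the 3-matrix -/

section

variable {k n r m : ℕ} [NeZero r] [NeZero m] (G : Matrix (Fin k) (Fin n) (ZMod 2))

/-- At most one triangle has three given edges, so the encoding commutes with this sum. -/
theorem entryCode_array (x y z : Fin (9 * (r * m))) :
    entryCode (array G r m x y z) =
      ∑ t : Fin 23 × (Fin r × Fin m), if inc 0 t = x ∧ inc 1 t = y ∧ inc 2 t = z then
        code G r t.2.1 t.2.2 t.1 else 0 := by
  rw [array, Finset.sum_filter]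
  by_cases h : ∃ t : Fin 23 × (Fin r × Fin m), inc 0 t = x ∧ inc 1 t = y ∧ inc 2 t = z
  · obtain ⟨t, rfl, rfl, rfl⟩ := h
    have huniq : ∀ t', t' ≠ t →
        ¬(inc 0 t' = inc 0 t ∧ inc 1 t' = inc 1 t ∧ inc 2 t' = inc 2 t) := fun t' hne h =>
      hne (inc_inj _ _ fun p => by
        fin_cases p
        exacts [h.1, h.2.1, h.2.2])
    rw [Finset.sum_eq_single t (fun t' _ h => if_neg (huniq t' h)) (by simp),
      Finset.sum_eq_single t (fun t' _ h => if_neg (huniq t' h)) (by simp),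
      if_pos ⟨rfl, rfl, rfl⟩, if_pos ⟨rfl, rfl, rfl⟩, entry, entryCode]
    split_ifs with h1 h2 h2
    · exact h1.symm
    · exact absurd rfl h2
    · exact absurd h2 (Polynomial.monic_X_pow _).ne_zero
    · rw [Polynomial.natDegree_X_pow]
      omega
  · have h' : ∀ t : Fin 23 × (Fin r × Fin m), ¬(inc 0 t = x ∧ inc 1 t = y ∧ inc 2 t = z) :=
      fun t ht => h ⟨t, ht⟩
    rw [Finset.sum_eq_zero fun t _ => if_neg (h' t), Finset.sum_eq_zero fun t _ => if_neg (h' t),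
      entryCode, if_pos rfl]

/-- The three edge numbers are the base-N digits of the position, with N = 9rm, so equal positions
mean equal edges. -/
theorem sum_cellSum (x y z : Fin (9 * (r * m))) :
    ∑ i ∈ Finset.range r, ∑ j ∈ Finset.range m,
      cellSum G r m i j (9 * (r * m) + ((x * (9 * (r * m)) + y) * (9 * (r * m)) + z)) =
      entryCode (array G r m x y z) := by
  have hN : ∀ {N a b c a' b' c' : ℕ}, b < N → c < N → b' < N → c' < N →
      ((a * N + b) * N + c = (a' * N + b') * N + c' ↔ a = a' ∧ b = b' ∧ c = c') := by
    intro N a b c a' b' c' hb hc hb' hc'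
    have key : ∀ {u v u' v' : ℕ}, v < N → v' < N → u * N + v = u' * N + v' → u = u' ∧ v = v' := by
      intro u v u' v' hv hv' h
      have h1 := congrArg (· / N) h
      have h2 := congrArg (· % N) h
      have hN : 0 < N := by omega
      simp only [mul_comm _ N, Nat.mul_add_div hN, Nat.div_eq_of_lt hv, Nat.div_eq_of_lt hv',
        Nat.mul_add_mod, Nat.mod_eq_of_lt hv, Nat.mod_eq_of_lt hv', add_zero] at h1 h2
      exact ⟨h1, h2⟩
    constructor
    · intro h
      obtain ⟨h1, h2⟩ := key hc hc' h
      obtain ⟨h3, h4⟩ := key hb hb' h1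
      exact ⟨h3, h4, h2⟩
    · rintro ⟨rfl, rfl, rfl⟩
      rfl
  rw [entryCode_array, Fintype.sum_prod_type_right, Fintype.sum_prod_type, Finset.sum_range]
  refine Finset.sum_congr rfl fun i _ => ?_
  rw [Finset.sum_range]
  refine Finset.sum_congr rfl fun j _ => Finset.sum_congr rfl fun κ _ => ?_
  refine if_congr ?_ rfl rfl
  rw [add_right_inj, posNat, ← val_inc, ← val_inc, ← val_inc,
    hN (Fin.is_lt _) (Fin.is_lt _) (Fin.is_lt _) (Fin.is_lt _)]
  simp only [Fin.ext_iff]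

end

theorem computesWithin_gridProgram {k n : ℕ} (G : Matrix (Fin k) (Fin n) (ZMod 2)) (hk : k ≤ n) :
    ComputesWithin gridProgram G (array G (2 * (n + 2)) (n + 2)) (gridCost n) := by
  intro s ⟨hreg, h0, h1, hG, hrest⟩
  obtain ⟨t₁, s₁, ht₁, hr₁, hm₁, hcore⟩ := exists_runs_init hk hreg h0 h1
  have hN : 2 + k * n ≤ 9 * (2 * (n + 2) * (n + 2)) := by
    have := Nat.mul_le_mul_right n hk
    nlinarith
  obtain ⟨t₂, s₂, ht₂, hr₂, hcore₂, hm₂⟩ := exists_runs_loops G h0 hG (by omega) (by omega)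
    (by omega) hN hcore hm₁
  refine ⟨_, s₂, Nat.add_le_add ht₁ ht₂, hr₁.seq hr₂, hcore₂.size, fun x y z => ?_⟩
  -- By `hN` the input ends before the output area, which is therefore zero at the start.
  rw [hcore₂.base, hm₂, hrest _ (by omega), zero_add]
  exact sum_cellSum G x y z

end Grid

/-! ### Weight enumerators -/

/-- Encoding is a bijection onto the code: injective by independence of the rows, surjective because
they span. -/
theorem weightEnumerator_eq_sum {k n : ℕ} {C : Submodule (ZMod 2) (Fin n → ZMod 2)}
    {G : Matrix (Fin k) (Fin n) (ZMod 2)} (h : IsGeneratorMatrix G C) :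
    weightEnumerator C =
      ∑ u : Fin k → ZMod 2, (Polynomial.X : ℕ[X]) ^ hammingNorm (Matrix.vecMul u G) := by
  classical
  unfold weightEnumerator
  symm
  refine Finset.sum_bij (fun u _ => Matrix.vecMul u G) (fun u _ => ?_) (fun u _ u' _ huu' => ?_)
    (fun c hc => ?_) fun u _ => rfl
  · rw [Finset.mem_filter, ← h.2]
    refine ⟨Finset.mem_univ _, ?_⟩
    rw [Matrix.vecMul_eq_sum]
    exact Submodule.sum_mem _ fun i _ => Submodule.smul_mem _ _ (Submodule.subset_span ⟨i, rfl⟩)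
  · exact Matrix.vecMul_injective_iff.2 h.1 huu'
  · have hc := (Finset.mem_filter.1 hc).2
    rw [← h.2, Submodule.mem_span_range_iff_exists_fun] at hc
    obtain ⟨u, hu⟩ := hc
    exact ⟨u, Finset.mem_univ _, by rw [Matrix.vecMul_eq_sum]; exact hu⟩

theorem IsGeneratorMatrix.le {k n : ℕ} {C : Submodule (ZMod 2) (Fin n → ZMod 2)}
    {G : Matrix (Fin k) (Fin n) (ZMod 2)} (h : IsGeneratorMatrix G C) : k ≤ n := by
  simpa using h.1.fintype_card_le_finrank

/-- A re-indexing of the exponents of a sum of powers. -/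
theorem sum_monomial_sum_X_pow {ι : Type*} (S : Finset ι) (d : ι → ℕ) (φ : ℕ → ℕ) :
    (∑ u ∈ S, (Polynomial.X : ℕ[X]) ^ d u).sum (fun i a => Polynomial.monomial (φ i) a) =
      ∑ u ∈ S, Polynomial.X ^ φ (d u) := by
  classical
  induction S using Finset.induction_on with
  | empty => simp
  | insert u S hu ih =>
    rw [Finset.sum_insert hu, Finset.sum_insert hu, Polynomial.sum_add_index _ _ _ (by simp)
      (by simp), ih, Polynomial.X_pow_eq_monomial, Polynomial.sum_monomial_index _ _ (by simp),
      Polynomial.X_pow_eq_monomial]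

theorem exists_eq_of_mem_support_sum_X_pow {ι : Type*} {S : Finset ι} {d : ι → ℕ} {i : ℕ}
    (h : i ∈ (∑ u ∈ S, (Polynomial.X : ℕ[X]) ^ d u).support) : ∃ u ∈ S, i = d u := by
  by_contra! h'
  rw [Polynomial.mem_support_iff, Polynomial.finsetSum_coeff] at h
  exact h (Finset.sum_eq_zero fun u hu => by rw [Polynomial.coeff_X_pow, if_neg (h' u hu)])

theorem theorem1p1 :
    ∃ (α β : ℕ) (P : RAM.Program) (q : Polynomial ℕ), 0 < β ∧
      ∀ (n : ℕ) (C : Submodule (ZMod 2) (Fin n → ZMod 2))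
        (k : ℕ) (G : Matrix (Fin k) (Fin n) (ZMod 2)), IsGeneratorMatrix G C →
        ∃ (Δ : TriangularConfiguration) (E : Δ.Tripartition) (w : Δ.triangles → ℕ)
          (N : ℕ) (ν : ∀ p : Fin 3, Fin N ≃ E.part p),
          -- the exponents `(i mod e) / 2`, with `e = α n + β`, are integers
          (∀ i ∈ (permanent3 (Δ.triadjacency E w ν)).support, Even (i % (α * n + β))) ∧
          -- `W_C(x) = ∑ a_i x ^ ((i mod e) / 2)`, where `Per A_Δ(x) = ∑ a_i x ^ i`
          weightEnumerator C = (permanent3 (Δ.triadjacency E w ν)).sum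
            (fun i a => Polynomial.monomial (i % (α * n + β) / 2) a) ∧
          -- the 3-matrix has polynomial size and is computed in polynomial time
          N ≤ q.eval n ∧ (∀ t, w t ≤ q.eval n) ∧
          RAM.ComputesWithin P G (Δ.triadjacency E w ν) (q.eval n) := by
  obtain ⟨q, hq⟩ := ((Grid.polyBounded_gridCost.add Grid.polyBounded_size).add (.const 2))
  -- The modulus `2 * n + 1` is larger than twice any weight.
  refine ⟨2, 1, Grid.gridProgram, q, one_pos, fun n C k G hG => ?_⟩
  have hkn := hG.le
  have : NeZero (2 * (n + 2)) := ⟨by omega⟩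
  -- The number of rows must be even, larger than `k` and at least 3, the number of columns at least
  -- `n` and at least 2, for every `n` including 0.
  obtain ⟨Δ, E, w, ν, hw, hA⟩ := Grid.exists_triadjacency_eq_array (r := 2 * (n + 2)) (m := n + 2) G
    (by omega) (by omega)
  have hq : Grid.gridCost n + 9 * (2 * (n + 2) * (n + 2)) + 2 ≤ q.eval n := hq n
  have hper : permanent3 (Δ.triadjacency E w ν) =
      ∑ u : Fin k → ZMod 2, Polynomial.X ^ (2 * hammingNorm (Matrix.vecMul u G)) := by
    rw [hA]
    exact Grid.permanent3_entry G (by omega) (by omega) (even_two_mul _)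
  have hlt : ∀ u : Fin k → ZMod 2, 2 * hammingNorm (Matrix.vecMul u G) % (2 * n + 1) =
      2 * hammingNorm (Matrix.vecMul u G) := fun u => Nat.mod_eq_of_lt <| by
    have := hammingNorm_le_card_fintype (x := Matrix.vecMul u G)
    rw [Fintype.card_fin] at this
    omega
  refine ⟨Δ, E, w, _, ν, fun i hi => ?_, ?_, by omega, fun t => ?_, ?_⟩
  · rw [hper] at hi
    obtain ⟨u, -, rfl⟩ := exists_eq_of_mem_support_sum_X_pow hi
    rw [hlt]
    exact even_two_mul _
  · rw [hper, sum_monomial_sum_X_pow _ _ fun i => i % (2 * n + 1) / 2, weightEnumerator_eq_sum hG]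
    refine Finset.sum_congr rfl fun u _ => ?_
    rw [hlt, Nat.mul_div_cancel_left _ two_pos]
  · have := hw t
    omega
  · rw [hA]
    intro s hs
    obtain ⟨t, s', ht, h⟩ := Grid.computesWithin_gridProgram G hkn s hs
    exact ⟨t, s', by omega, h⟩
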